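/- Let $G$ be a finite group and $p$ a prime. For a finite group $K$ write $O_p(K)$ for its largest normal $p$-subgroup; $K$ has *characteristic $p$* if $C_K(O_p(K))\le O_p(K)$, and *parabolic characteristic $p$* if every $p$-local subgroup of $K$ (normalizer of a nontrivial $p$-subgroup) that contains a Sylow $p$-subgroup of $K$ has characteristic $p$. An element of order $p$ of $K$ is *$p$-central* if it lies in the center of some Sylow $p$-subgroup of $K$. Let $\widehat{\mathcal S}_p(K)$ be the poset, under inclusion, of the nontrivial $p$-subgroups of $K$ whose center contains a $p$-central element of $K$. **Theorem 4.12.** Assume that $G$ has parabolic characteristic $p$. Let $T\le G$ be a subgroup of order $p$ none of whose elements is $p$-central in $G$, and put $C=C_G(T)$ and $\overline C=C/O_p(C)$. Assume that $C$ does not have characteristic $p$ and that $\overline C$ has parabolic characteristic $p$. Let $\widehat{\mathcal S}_p(G)^T=\{Q\in\widehat{\mathcal S}_p(G) : T\le N_G(Q)\}$, on which $N_G(T)$ acts by conjugation, and let $N_G(T)$ act on $\widehat{\mathcal S}_p(\overline C)$ through its conjugation action on $C$. Then the geometric realizations of the order complexes of $\widehat{\mathcal S}_p(G)^T$ and $\widehat{\mathcal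 S}_p(\overline C)$ are $N_G(T)$-equivariantly homotopy equivalent: there are continuous $N_G(T)$-equivariant maps in both directions whose two composites are homotopic to the identities through $N_G(T)$-equivariant maps. -/

import Mathlib

open Subgroup
open scoped Pointwise unitInterval

noncomputable section

/-! ### Finite posets as topological spaces -/

/-- The geometric realization of the order complex (the nerve) of a finite poset `α`, in barycentric
coordinates: functions `w : α → [0, ∞)` of total mass `1` whose support is a chain of `α`. -/
def OrderComplex (α : Type*) [PartialOrder α] [Finite α] : Type _ :=
  {w : α → ℝ // (∀ a, 0 ≤ w a) ∧ ∑ᶠ a, w a = 1 ∧ IsChain (· ≤ ·) (Function.support w)}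

namespace OrderComplex

variable {α : Type*} [PartialOrder α] [Finite α]

/-- The subspace topology from `α → ℝ` (the usual topology, since `α` is finite). -/
instance instTopologicalSpace : TopologicalSpace (OrderComplex α) :=
  inferInstanceAs (TopologicalSpace
    {w : α → ℝ // (∀ a, 0 ≤ w a) ∧ ∑ᶠ a, w a = 1 ∧ IsChain (· ≤ ·) (Function.support w)})

/-- An order-preserving action of a group `H` on `α` extends to the realization of the order
complex, affinely on each simplex: the vertex `a` is sent to the vertex `h • a`. -/
instance instMulAction (H : Type*) [Group H] [MulAction H α] [CovariantClass H α (· • ·) (· ≤ ·)] :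
    MulAction H (OrderComplex α) where
  smul h w := ⟨fun a => w.1 (h⁻¹ • a), fun a => w.2.1 _, 
      (finsum_comp_equiv (MulAction.toPerm h⁻¹) (f := w.1)).trans w.2.2.1, by
      intro a ha b hb hab
      rcases w.2.2.2 ha hb (fun e => hab (MulAction.injective h⁻¹ e)) with hle | hle
      · left
        simpa using CovariantClass.elim (μ := (· • ·)) (r := (· ≤ ·)) h hle
      · right
        simpa using CovariantClass.elim (μ := (· • ·)) (r := (· ≤ ·)) h hle⟩
  one_smul w := Subtype.ext (funext fun a => congrArg w.1 (by simp))
  mul_smul g h w := Subtype.ext (funext fun a => congrArg w.1 (by simp [mul_smul]))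

end OrderComplex

/-- `X` and `Y` are `H`-equivariantly homotopy equivalent: there are `H`-maps `f : X → Y` and
`g : Y → X` such that `g ∘ f` and `f ∘ g` are homotopic to the identities through `H`-maps. -/
def EquivariantlyHomotopyEquivalent (H X Y : Type*) [Group H]
    [TopologicalSpace X] [MulAction H X] [TopologicalSpace Y] [MulAction H Y] : Prop :=
  ∃ (f : C(X, Y)) (g : C(Y, X)) (F : (g.comp f).Homotopy (ContinuousMap.id X))
    (F' : (f.comp g).Homotopy (ContinuousMap.id Y)),
    (∀ (h : H) (x : X), f (h • x) = h • f x) ∧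
    (∀ (h : H) (y : Y), g (h • y) = h • g y) ∧
    (∀ (h : H) (t : I) (x : X), F (t, h • x) = h • F (t, x)) ∧
    (∀ (h : H) (t : I) (y : Y), F' (t, h • y) = h • F' (t, y))

/-! ### Characteristic `p` and parabolic characteristic `p` -/

/-- `O_p(K)`, the largest normal `p`-subgroup of `K` (for finite `K`). -/
def pCore (p : ℕ) (K : Type*) [Group K] : Subgroup K :=
  sSup {N : Subgroup K | N.Normal ∧ IsPGroup p N}

/-- `K` has characteristic `p`: `C_K(O_p(K)) ≤ O_p(K)`. -/
def HasCharacteristic (p : ℕ) (K : Type*) [Group K] : Prop :=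
  centralizer (pCore p K : Set K) ≤ pCore p K

/-- A `p`-local subgroup: the normalizer of a nontrivial `p`-subgroup. -/
def IsPLocal (p : ℕ) {K : Type*} [Group K] (L : Subgroup K) : Prop :=
  ∃ Q : Subgroup K, IsPGroup p Q ∧ Q ≠ ⊥ ∧ L = normalizer (Q : Set K)

/-- A parabolic subgroup: one that contains a Sylow `p`-subgroup. -/
def IsParabolic (p : ℕ) {K : Type*} [Group K] (L : Subgroup K) : Prop :=
  ∃ S : Sylow p K, (S : Subgroup K) ≤ L

/-- `K` has parabolic characteristic `p`: all its `p`-local parabolic subgroups have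
characteristic `p`. -/
def HasParabolicCharacteristic (p : ℕ) (K : Type*) [Group K] : Prop :=
  ∀ L : Subgroup K, IsPLocal p L → IsParabolic p L → HasCharacteristic p L

/-! ### Distinguished collections -/

/-- `x` is a `p`-central element of `K`: it has order `p` and lies in the center of a Sylow
`p`-subgroup of `K`. -/
def IsPCentral (p : ℕ) {K : Type*} [Group K] (x : K) : Prop :=
  orderOf x = p ∧ ∃ S : Sylow p K, x ∈ (center S).map (S : Subgroup K).subtype

/-- `T` is a subgroup of order `p` of noncentral type: its elements of order `p` are not
`p`-central (the Sylow `p`-subgroups form a full conjugacy class, so this also says that they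
are not conjugate to elements of the center of a given one). -/
def IsNoncentralOfOrder (p : ℕ) {K : Type*} [Group K] (T : Subgroup K) : Prop :=
  Nat.card T = p ∧ ∀ x ∈ T, ¬ IsPCentral p x

/-- `Ω₁ Z(P)`, the subgroup of `K` generated by the `x ∈ Z(P)` with `x ^ p = 1`. -/
def omegaOneCenter (p : ℕ) {K : Type*} [Group K] (P : Subgroup K) : Subgroup K :=
  closure {x : K | x ∈ (center P).map P.subtype ∧ x ^ p = 1}

/-- The subgroup generated by the `p`-central elements of `K` that lie in `Ω₁ Z(P)`. -/
def centralHat (p : ℕ) {K : Type*} [Group K] (P : Subgroup K) : Subgroup K :=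
  closure {x : K | x ∈ omegaOneCenter p P ∧ IsPCentral p x}

/-- The Brown collection of nontrivial `p`-subgroups of `K`. -/
def brown (p : ℕ) (K : Type*) [Group K] : Set (Subgroup K) :=
  {P | IsPGroup p P ∧ P ≠ ⊥}

/-- The distinguished Brown collection: the nontrivial `p`-subgroups of `K` that contain
`p`-central elements of `K` in their centers. -/
def distinguishedBrown (p : ℕ) (K : Type*) [Group K] : Set (Subgroup K) :=
  {P | P ∈ brown p K ∧ centralHat p P ≠ ⊥}

/-- The part of a collection `𝒞` of subgroups that is fixed under conjugation by `P`. -/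
def fixedCollection {K : Type*} [Group K] (𝒞 : Set (Subgroup K)) (P : Subgroup K) :
    Set (Subgroup K) :=
  {Q | Q ∈ 𝒞 ∧ P ≤ normalizer (Q : Set K)}

/-! ### The actions -/

section Actions

variable (p : ℕ) {K : Type*} [Group K]

theorem pCore_map_mulAut (φ : K ≃* K) : (pCore p K).map (φ : K →* K) = pCore p K := by
  have key : ∀ ψ : K ≃* K, (pCore p K).map (ψ : K →* K) ≤ pCore p K := by
    intro ψ
    rw [map_le_iff_le_comap]
    refine sSup_le fun N hN => ?_
    rw [← map_le_iff_le_comap]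
    exact le_sSup ⟨hN.1.map _ ψ.surjective, hN.2.map _⟩
  refine le_antisymm (key φ) fun x hx => ?_
  exact ⟨φ.symm x, key φ.symm ⟨x, hx, rfl⟩, by simp⟩

instance pCore_normal : (pCore p K).Normal where
  conj_mem x hx g := by
    have h := pCore_map_mulAut p (MulAut.conj g : K ≃* K)
    rw [← h]
    exact ⟨x, hx, by simp⟩

/-- The automorphism of `K / O_p(K)` induced by an automorphism of `K`. -/
def quotientPCoreAut : MulAut K →* MulAut (K ⧸ pCore p K) where
  toFun φ := QuotientGroup.congr _ _ φ (pCore_map_mulAut p φ)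
  map_one' := by
    ext x
    induction x using QuotientGroup.induction_on with
    | H z => rfl
  map_mul' φ ψ := by
    ext x
    induction x using QuotientGroup.induction_on with
    | H z => rfl

theorem normalizer_le_normalizer_centralizer (T : Subgroup K) :
    normalizer (T : Set K) ≤ normalizer (centralizer (T : Set K) : Set K) := by
  have key : ∀ g ∈ normalizer (T : Set K), ∀ n ∈ centralizer (T : Set K),
      g * n * g⁻¹ ∈ centralizer (T : Set K) := by
    intro g hg n hn t ht
    have h := hn (g⁻¹ * t * g) (by
      have := (mem_normalizer_iff.1 (inv_mem hg) t).1 ht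
      simpa using this)
    calc t * (g * n * g⁻¹) = g * ((g⁻¹ * t * g) * n) * g⁻¹ := by group
      _ = g * (n * (g⁻¹ * t * g)) * g⁻¹ := by rw [h]
      _ = g * n * g⁻¹ * t := by group
  intro g hg
  refine mem_normalizer_iff.2 fun n => ⟨key g hg n, fun h => ?_⟩
  have h' := key g⁻¹ (inv_mem hg) _ h
  simpa [mul_assoc] using h'

/-- `N_K(T)` acts on `C_K(T)` by conjugation. -/
def conjCentralizer (T : Subgroup K) :
    normalizer (T : Set K) →* MulAut (centralizer (T : Set K)) :=
  (centralizer (T : Set K)).normalizerMonoidHom.comp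
    (inclusion (normalizer_le_normalizer_centralizer T))

/-- The quotient `C_K(T) / O_p(C_K(T))`. -/
abbrev CentralizerQuotient (T : Subgroup K) : Type _ :=
  centralizer (T : Set K) ⧸ pCore p (centralizer (T : Set K))

/-- The conjugation action of `N_K(T)` on `C_K(T) / O_p(C_K(T))`. -/
def conjCentralizerQuotient (T : Subgroup K) :
    normalizer (T : Set K) →* MulAut (CentralizerQuotient p T) :=
  (quotientPCoreAut p).comp (conjCentralizer T)

variable {p}

theorem IsPCentral.mulAut {x : K} (hx : IsPCentral p x) (φ : MulAut K) :
    IsPCentral p (φ x) := by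
  obtain ⟨ho, S, ⟨z, hz, rfl⟩⟩ := hx
  refine ⟨(φ.orderOf_eq _).trans ho, φ • S, ?_⟩
  have hzS : φ (z : K) ∈ ((φ • S : Sylow p K) : Subgroup K) := by
    rw [Sylow.pointwise_smul_def]
    exact smul_mem_pointwise_smul (z : K) φ (S : Subgroup K) z.2
  refine ⟨⟨φ (z : K), hzS⟩, ?_, rfl⟩
  rw [SetLike.mem_coe, mem_center_iff]
  rintro ⟨y, hy⟩
  rw [Sylow.pointwise_smul_def, mem_pointwise_smul_iff_inv_smul_mem] at hy
  have h := congrArg (fun u : S => φ (u : K)) (mem_center_iff.1 hz ⟨φ⁻¹ • y, hy⟩)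
  refine Subtype.ext ?_
  simpa using h

theorem map_center_mulAut (P : Subgroup K) (φ : MulAut K) {x : K}
    (hx : x ∈ (center P).map P.subtype) :
    φ x ∈ (center (φ • P : Subgroup K)).map (φ • P : Subgroup K).subtype := by
  obtain ⟨z, hz, rfl⟩ := hx
  refine ⟨⟨φ (z : K), smul_mem_pointwise_smul (z : K) φ P z.2⟩, ?_, rfl⟩
  rw [SetLike.mem_coe, mem_center_iff]
  rintro ⟨y, hy⟩
  rw [mem_pointwise_smul_iff_inv_smul_mem] at hy
  have h := congrArg (fun u : P => φ (u : K)) (mem_center_iff.1 hz ⟨φ⁻¹ • y, hy⟩)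
  refine Subtype.ext ?_
  simpa using h

theorem omegaOneCenter_mulAut (P : Subgroup K) (φ : MulAut K) {x : K}
    (hx : x ∈ omegaOneCenter p P) : φ x ∈ omegaOneCenter p (φ • P) := by
  have h : omegaOneCenter p P ≤ (omegaOneCenter p (φ • P)).comap (φ : K →* K) := by
    refine (closure_le _).2 fun y hy => ?_
    exact subset_closure ⟨map_center_mulAut P φ hy.1, by
      change (φ y) ^ p = 1
      rw [← map_pow, hy.2, map_one]⟩
  exact h hx

theorem smul_mem_distinguishedBrown {P : Subgroup K} (hP : P ∈ distinguishedBrown p K)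
    (φ : MulAut K) : φ • P ∈ distinguishedBrown p K := by
  obtain ⟨⟨h1, h2⟩, h3⟩ := hP
  refine ⟨⟨h1.map _, fun h => h2 ?_⟩, fun h => h3 ?_⟩
  · rw [eq_bot_iff] at h ⊢
    intro x hx
    have := h (smul_mem_pointwise_smul x φ P hx)
    simpa using this
  · rw [eq_bot_iff] at h ⊢
    refine (closure_le _).2 fun x hx => ?_
    have := h (subset_closure ⟨omegaOneCenter_mulAut P φ hx.1, hx.2.mulAut φ⟩)
    simpa using this

/-- Automorphisms of `K` act on the distinguished Brown collection of `K`, by `P ↦ φ(P)`. -/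
instance distinguishedBrownMulAction : MulAction (MulAut K) (distinguishedBrown p K) where
  smul φ P := ⟨φ • (P : Subgroup K), smul_mem_distinguishedBrown P.2 φ⟩
  one_smul P := Subtype.ext (one_smul (MulAut K) (P : Subgroup K))
  mul_smul φ ψ P := Subtype.ext (mul_smul φ ψ (P : Subgroup K))

/-- `N_K(T)` acts by conjugation on the distinguished Brown collection of
`C_K(T) / O_p(C_K(T))`. -/
instance quotientBrownMulAction (T : Subgroup K) :
    MulAction (normalizer (T : Set K)) (distinguishedBrown p (CentralizerQuotient p T)) :=
  MulAction.compHom _ (conjCentralizerQuotient p T)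

instance quotientBrownMono (T : Subgroup K) :
    CovariantClass (normalizer (T : Set K)) (distinguishedBrown p (CentralizerQuotient p T))
      (· • ·) (· ≤ ·) where
  elim _ _ _ h := pointwise_smul_le_pointwise_smul_iff.2 h

theorem conj_smul_le_normalizer {T Q : Subgroup K} (hQ : T ≤ normalizer (Q : Set K)) {g : K}
    (hg : g ∈ normalizer (T : Set K)) :
    T ≤ normalizer ((MulAut.conj g • Q : Subgroup K) : Set K) := by
  intro t ht
  have h1 : g⁻¹ * t * g ∈ normalizer (Q : Set K) :=
    hQ (by simpa using (mem_normalizer_iff.1 (inv_mem hg) t).1 ht)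
  refine mem_normalizer_iff.2 fun n => ?_
  have h2 := mem_normalizer_iff.1 h1 (g⁻¹ * n * g)
  rw [mem_pointwise_smul_iff_inv_smul_mem, mem_pointwise_smul_iff_inv_smul_mem, ← map_inv]
  simpa [mul_assoc] using h2

/-- `N_K(T)` acts by conjugation on the `T`-fixed part of the distinguished Brown collection
of `K`. -/
instance fixedBrownMulAction (T : Subgroup K) :
    MulAction (normalizer (T : Set K)) (fixedCollection (distinguishedBrown p K) T) where
  smul g Q := ⟨MulAut.conj (g : K) • (Q : Subgroup K),
    smul_mem_distinguishedBrown Q.2.1 _, conj_smul_le_normalizer Q.2.2 g.2⟩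
  one_smul Q := Subtype.ext (by
    change MulAut.conj (1 : K) • (Q : Subgroup K) = Q
    rw [map_one, one_smul])
  mul_smul g h Q := Subtype.ext (by
    change MulAut.conj ((g : K) * (h : K)) • (Q : Subgroup K) = _
    rw [map_mul, mul_smul]
    rfl)

instance fixedBrownMono (T : Subgroup K) :
    CovariantClass (normalizer (T : Set K)) (fixedCollection (distinguishedBrown p K) T)
      (· • ·) (· ≤ ·) where
  elim _ _ _ h := pointwise_smul_le_pointwise_smul_iff.2 h

end Actions

end

noncomputable section

/-! ### Equivariant homotopy equivalences -/

section EquivariantHomotopy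

variable {H X Y Z : Type*} [Group H] [TopologicalSpace X] [MulAction H X] [TopologicalSpace Y]
  [MulAction H Y] [TopologicalSpace Z]

/-! Write `C = C_G(T)`. The equivalence is a chain of four: from all `T`-invariant distinguished
subgroups to those containing `T`, then to those between `T` and `C`, then to the distinguished
subgroups of `C / O_p(C)` whose preimage is distinguished in `G`, and finally to all distinguished
subgroups of `C / O_p(C)`. The last poset is the larger one in its step, so that equivalence is used
backwards.

The second step is the decreasing retraction `Q ↦ Q ∩ C`. The other three discard subgroups `P`
whose upper link `{R | P < R}` contracts through `R ≥ N_R(P) ≤ N_R(P) T O_p(N(P)) ≥ T O_p(N(P))`,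
with normalizers taken in `G`, `C` or `C / O_p(C)`, and `T` replaced by the trivial group in the
quotient. The contraction exists as soon as `P` is strictly below `T O_p(N(P))`, so it has to be
shown that equality puts `P` in the smaller poset.

Two group-theoretic facts make this work. First, the normalizer of a distinguished subgroup has
characteristic `p` (`HasParabolicCharacteristic.of_mem_distinguishedBrown`), by Thompson's `A × B`
lemma. Hence a `p`-subgroup `D` containing `O_p(N(P))` is distinguished: a `p`-central element in
the center of a Sylow subgroup above `D` centralizes `O_p(N(P))`, so it lies in it. Second, `O_p(C)`
contains no `p`-central element of `G`, since otherwise `C` would have characteristic `p`. So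
`p`-central elements of `G` in `C` survive in the quotient, and centrality can be compared on both
sides (`exists_isPCentral_centralizing_preimage`).

The topology is done with explicit formulas in barycentric coordinates (`slide`, `contract`,
`pushOff`), where equivariance can be read off directly. Subgroups are discarded in increasing order
of size, so that the upper link of each one is still complete when it is removed. -/

theorem EquivariantlyHomotopyEquivalent.symm (h : EquivariantlyHomotopyEquivalent H X Y) :
    EquivariantlyHomotopyEquivalent H Y X := by
  obtain ⟨f, g, F, F', hf, hg, hF, hF'⟩ := h
  exact ⟨g, f, F', F, hg, hf, hF', hF⟩

/-- The homotopy `g₁ g₂ f₂ f₁ ≃ g₁ f₁ ≃ id` obtained from `g₂ f₂ ≃ id` and `g₁ f₁ ≃ id`. -/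
def nestedHomotopy {f₁ : C(X, Y)} {g₁ : C(Y, X)} {f₂ : C(Y, Z)} {g₂ : C(Z, Y)}
    (F₁ : (g₁.comp f₁).Homotopy (ContinuousMap.id X))
    (F₂ : (g₂.comp f₂).Homotopy (ContinuousMap.id Y)) :
    ((g₁.comp g₂).comp (f₂.comp f₁)).Homotopy (ContinuousMap.id X) :=
  ContinuousMap.Homotopy.trans
    { toFun := fun q => g₁ (F₂ (q.1, f₁ q.2))
      continuous_toFun := by fun_prop
      map_zero_left := fun x => by simp
      map_one_left := fun x => by simp } F₁

theorem nestedHomotopy_smul {f₁ : C(X, Y)} {g₁ : C(Y, X)} {f₂ : C(Y, Z)} {g₂ : C(Z, Y)}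
    {F₁ : (g₁.comp f₁).Homotopy (ContinuousMap.id X)}
    {F₂ : (g₂.comp f₂).Homotopy (ContinuousMap.id Y)}
    (hf₁ : ∀ (h : H) (x : X), f₁ (h • x) = h • f₁ x)
    (hg₁ : ∀ (h : H) (y : Y), g₁ (h • y) = h • g₁ y)
    (hF₁ : ∀ (h : H) (t : I) (x : X), F₁ (t, h • x) = h • F₁ (t, x))
    (hF₂ : ∀ (h : H) (t : I) (y : Y), F₂ (t, h • y) = h • F₂ (t, y)) (h : H) (t : I) (x : X) :
    nestedHomotopy F₁ F₂ (t, h • x) = h • nestedHomotopy F₁ F₂ (t, x) := by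
  unfold nestedHomotopy
  rw [ContinuousMap.Homotopy.trans_apply, ContinuousMap.Homotopy.trans_apply]
  split_ifs
  · change g₁ (F₂ (_, f₁ (h • x))) = h • g₁ (F₂ (_, f₁ x))
    rw [hf₁, hF₂, hg₁]
  · exact hF₁ _ _ _

theorem EquivariantlyHomotopyEquivalent.trans [MulAction H Z]
    (h₁ : EquivariantlyHomotopyEquivalent H X Y)
    (h₂ : EquivariantlyHomotopyEquivalent H Y Z) : EquivariantlyHomotopyEquivalent H X Z := by
  obtain ⟨f₁, g₁, F₁, F₁', hf₁, hg₁, hF₁, hF₁'⟩ := h₁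
  obtain ⟨f₂, g₂, F₂, F₂', hf₂, hg₂, hF₂, hF₂'⟩ := h₂
  exact ⟨f₂.comp f₁, g₁.comp g₂, nestedHomotopy F₁ F₂, nestedHomotopy F₂' F₁',
    fun h x => by simp [hf₁, hf₂], fun h x => by simp [hg₁, hg₂],
    nestedHomotopy_smul hf₁ hg₁ hF₁ hF₂, nestedHomotopy_smul hg₂ hf₂ hF₂' hF₁'⟩

/-- `X` deforms `H`-equivariantly into the subset `A`, with `A` fixed pointwise. -/
def EquivariantlyDeformsInto (H : Type*) {X : Type*} [Group H] [TopologicalSpace X] [MulAction H X]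
    (A : Set X) : Prop :=
  ∃ F : I × X → X, Continuous F ∧ (∀ x, F (0, x) = x) ∧ (∀ x, F (1, x) ∈ A) ∧
    (∀ t, ∀ x ∈ A, F (t, x) = x) ∧ ∀ (h : H) (t : I) (x : X), F (t, h • x) = h • F (t, x)

/-- The end of the deformation, read through the embedding, is a retraction. As the image of `ι` is
fixed throughout, one composite is the identity on the nose and only the other needs a homotopy. -/
theorem EquivariantlyDeformsInto.equivariantlyHomotopyEquivalent {ι : Y → X}
    (hι : Topology.IsEmbedding ι) (hsmul : ∀ (h : H) (y : Y), ι (h • y) = h • ι y)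
    (hX : EquivariantlyDeformsInto H (Set.range ι)) : EquivariantlyHomotopyEquivalent H X Y := by
  obtain ⟨F, hF, hF0, hF1, hFA, hFH⟩ := hX
  choose r hr using hF1
  have hrc : Continuous r := by
    rw [hι.continuous_iff]
    have : ι ∘ r = fun x => F (1, x) := funext hr
    rw [this]
    fun_prop
  have hrι : ∀ y, r (ι y) = y := fun y => hι.injective (by rw [hr, hFA _ _ ⟨y, rfl⟩])
  refine ⟨⟨r, hrc⟩, ⟨ι, hι.continuous⟩,
    { toFun := fun q => F (unitInterval.symm q.1, q.2)
      continuous_toFun := by fun_prop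
      map_zero_left := fun x => by simp [hr]
      map_one_left := fun x => by simp [hF0] },
    { toFun := fun q => q.2
      continuous_toFun := by fun_prop
      map_zero_left := fun x => by simp [hrι]
      map_one_left := fun x => by simp }, ?_, hsmul, ?_, ?_⟩
  · intro h x
    apply hι.injective
    change ι (r (h • x)) = ι (h • r x)
    rw [hsmul, hr, hr, hFH]
  · intro h t x
    exact hFH h _ x
  · intro h t y
    rfl

end EquivariantHomotopy

/-! ### Weights on a finite poset -/

section Weights

theorem smul_lt_smul_iff_of_covariant {α H : Type*} [PartialOrder α] [Group H]
    [MulAction H α] [CovariantClass H α (· • ·) (· ≤ ·)] {h : H} {x y : α} : h • x < h • y ↔ x < y := by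
  have key : ∀ (k : H) {x y : α}, x < y → k • x < k • y := fun k x y hxy =>
    lt_of_le_of_ne (CovariantClass.elim (μ := (· • ·)) (r := (· ≤ ·)) k hxy.le)
      fun e => hxy.ne (MulAction.injective k e)
  exact ⟨fun hxy => by simpa using key h⁻¹ hxy, key h⟩

open Classical in
/-- The image of a weight under a map of index sets. -/
def pushforward {α β : Type*} [Fintype α] (f : α → β) (u : α → ℝ) : β → ℝ :=
  fun z => ∑ x, if f x = z then u x else 0

/-! ### Images of weights under maps of index sets. -/

section Pushforward

variable {α β : Type*} [Fintype α] {f : α → β} {u v : α → ℝ}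

theorem pushforward_nonneg (hu : ∀ x, 0 ≤ u x) (z : β) : 0 ≤ pushforward f u z :=
  Finset.sum_nonneg fun x _ => by split_ifs <;> simp [hu]

theorem exists_of_pushforward_ne_zero {z : β} (hz : pushforward f u z ≠ 0) :
    ∃ x, u x ≠ 0 ∧ f x = z := by
  obtain ⟨x, -, hx⟩ := Finset.exists_ne_zero_of_sum_ne_zero hz
  by_cases h : f x = z
  · exact ⟨x, by simpa [h] using hx, h⟩
  · simp [h] at hx

theorem sum_pushforward [Fintype β] (f : α → β) (u : α → ℝ) :
    ∑ z, pushforward f u z = ∑ x, u x := by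
  simp only [pushforward]
  rw [Finset.sum_comm]
  classical simp

theorem pushforward_zero : pushforward f (0 : α → ℝ) = 0 := by
  ext z
  simp [pushforward]

theorem pushforward_id (u : α → ℝ) : pushforward id u = u := by
  classical
  ext z
  simp [pushforward]

theorem pushforward_const [DecidableEq β] (e : β) (u : α → ℝ) :
    pushforward (fun _ => e) u = Pi.single e (∑ x, u x) := by
  ext z
  by_cases h : e = z
  · subst h
    simp [pushforward]
  · simp [pushforward, h]

theorem pushforward_apply_of_injective (hf : Function.Injective f) (u : α → ℝ) (x : α) :
    pushforward f u (f x) = u x := by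
  classical
  simp [pushforward, hf.eq_iff]

theorem continuous_pushforward {Y : Type*} [TopologicalSpace Y] (f : α → β) {u : Y → α → ℝ}
    (hu : Continuous u) : Continuous fun y => pushforward f (u y) := by
  refine continuous_pi fun z => continuous_finsetSum _ fun x _ => ?_
  split_ifs
  · fun_prop
  · exact continuous_const

end Pushforward

variable {α : Type*} [PartialOrder α]

/-- A nonnegative weight whose support is a chain contained in `s`. -/
structure IsChainWeight (s : Set α) (u : α → ℝ) : Prop where
  nonneg : ∀ x, 0 ≤ u x
  isChain : IsChain (· ≤ ·) (Function.support u)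
  mem : ∀ x, u x ≠ 0 → x ∈ s

variable [Fintype α]

open Classical in
/-- The total weight of the elements strictly below `x`. -/
def weightBelow (u : α → ℝ) (x : α) : ℝ := ∑ y, if y < x then u y else 0

/-- The part of the weight of `x` that is among the lowest `a` units of total weight. -/
def lowerMass (a : ℝ) (u : α → ℝ) (x : α) : ℝ := min (u x) (max 0 (a - weightBelow u x))

/-- The image of the weight `u` under `g`, except that the lowest `a` units are mapped by `f`. -/
def slide (f g : α → α) (a : ℝ) (u : α → ℝ) : α → ℝ :=
  pushforward f (lowerMass a u) + pushforward g (u - lowerMass a u)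

theorem continuous_slide {Y : Type*} [TopologicalSpace Y] (f g : α → α) {a : Y → ℝ}
    {u : Y → α → ℝ} (ha : Continuous a) (hu : Continuous u) :
    Continuous fun y => slide f g (a y) (u y) := by
  have hm : Continuous fun y => lowerMass (a y) (u y) := by
    refine continuous_pi fun x => ?_
    have : Continuous fun y => weightBelow (u y) x := by
      refine continuous_finsetSum _ fun z _ => ?_
      split_ifs
      · fun_prop
      · exact continuous_const
    unfold lowerMass
    fun_prop
  exact (continuous_pushforward f hm).add (continuous_pushforward g (hu.sub hm))

theorem sum_slide (f g : α → α) (a : ℝ) (u : α → ℝ) : ∑ z, slide f g a u z = ∑ x, u x := by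
  simp only [slide, Pi.add_apply, Finset.sum_add_distrib, sum_pushforward, Pi.sub_apply,
    Finset.sum_sub_distrib]
  ring

/-! ### Sliding weight from one monotone map to a larger one. -/

section Slide

variable {f g : α → α} {a : ℝ} {u : α → ℝ} {s : Set α}

theorem weightBelow_nonneg (hu : ∀ x, 0 ≤ u x) (x : α) : 0 ≤ weightBelow u x :=
  Finset.sum_nonneg fun y _ => by split_ifs <;> simp [hu]

theorem weightBelow_add_le_of_lt (hu : ∀ x, 0 ≤ u x) {x y : α} (hxy : y < x) :
    weightBelow u y + u y ≤ weightBelow u x := by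
  classical
  have h : u y = ∑ z, if z = y then u z else 0 := by simp
  conv_lhs => rw [h]
  unfold weightBelow
  rw [← Finset.sum_add_distrib]
  refine Finset.sum_le_sum fun z _ => ?_
  by_cases h1 : z < y
  · simp [h1, h1.ne, h1.trans hxy]
  · by_cases h2 : z = y
    · subst h2
      simp [hxy]
    · simp only [h1, h2, if_false, add_zero]
      split_ifs <;> simp [hu]

theorem weightBelow_add_le_sum (hu : ∀ x, 0 ≤ u x) (x : α) :
    weightBelow u x + u x ≤ ∑ y, u y := by
  classical
  have h : u x = ∑ z, if z = x then u z else 0 := by simp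
  conv_lhs => rw [h]
  unfold weightBelow
  rw [← Finset.sum_add_distrib]
  refine Finset.sum_le_sum fun z _ => ?_
  by_cases h1 : z < x
  · simp [h1, h1.ne]
  · simp only [h1, if_false, zero_add]
    split_ifs <;> simp [hu]

theorem lowerMass_zero (hu : ∀ x, 0 ≤ u x) : lowerMass 0 u = 0 := by
  ext x
  have h := weightBelow_nonneg hu x
  simp only [lowerMass, zero_sub, Pi.zero_apply]
  rw [max_eq_left (by linarith), min_eq_right (hu x)]

theorem lowerMass_one (hu : ∀ x, 0 ≤ u x) (hs : ∑ x, u x ≤ 1) : lowerMass 1 u = u := by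
  ext x
  have h := weightBelow_add_le_sum hu x
  exact min_eq_left (le_max_of_le_right (by linarith))

theorem slide_zero (hu : ∀ x, 0 ≤ u x) : slide f g 0 u = pushforward g u := by
  simp [slide, lowerMass_zero hu, pushforward_zero]

theorem slide_one (hu : ∀ x, 0 ≤ u x) (hs : ∑ x, u x ≤ 1) : slide f g 1 u = pushforward f u := by
  simp [slide, lowerMass_one hu hs, pushforward_zero]

theorem slide_self_id {u : α → ℝ} {a : ℝ} (hf : ∀ x, u x ≠ 0 → f x = x) :
    slide f id a u = u := by
  have h : pushforward f (lowerMass a u) = pushforward id (lowerMass a u) := by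
    ext z
    refine Finset.sum_congr rfl fun x _ => ?_
    by_cases hx : u x = 0
    · simp [lowerMass, hx]
    · rw [hf x hx, id]
  rw [slide, h, pushforward_id, pushforward_id, add_sub_cancel]

/-- The vertices sent by `f` lie at the bottom of the chain and those sent by `g` at the top, with
at most one vertex split between them. Hence `f x ≤ f y ≤ g y` whenever `x` is moved by `f` and `y`
by `g`. This gives the homotopy between comparable maps without triangulating a prism. -/
theorem isChainWeight_slide (hu : ∀ x, 0 ≤ u x) (hc : IsChain (· ≤ ·) (Function.support u))
    (hf : ∀ x y, u x ≠ 0 → u y ≠ 0 → x ≤ y → f x ≤ f y)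
    (hg : ∀ x y, u x ≠ 0 → u y ≠ 0 → x ≤ y → g x ≤ g y)
    (hfg : ∀ x, u x ≠ 0 → f x ≤ g x)
    (hfs : ∀ x, u x ≠ 0 → f x ∈ s) (hgs : ∀ x, u x ≠ 0 → g x ∈ s) :
    IsChainWeight s (slide f g a u) := by
  have hm0 : ∀ x, 0 ≤ lowerMass a u x := fun x => le_min (hu x) (le_max_left _ _)
  have hm1 : ∀ x, 0 ≤ (u - lowerMass a u) x := fun x => sub_nonneg.2 (min_le_left _ _)
  have hmoved : ∀ x, lowerMass a u x ≠ 0 → u x ≠ 0 ∧ weightBelow u x < a := by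
    intro x hx
    have hpos : 0 < lowerMass a u x := lt_of_le_of_ne (hm0 x) (Ne.symm hx)
    obtain ⟨h1, h2⟩ := lt_min_iff.1 hpos
    refine ⟨h1.ne', ?_⟩
    rcases lt_max_iff.1 h2 with h | h
    · exact absurd h (lt_irrefl _)
    · linarith
  have hkept : ∀ y, (u - lowerMass a u) y ≠ 0 → u y ≠ 0 ∧ a < weightBelow u y + u y := by
    intro y hy
    have hpos : 0 < u y - lowerMass a u y := lt_of_le_of_ne (hm1 y) (Ne.symm hy)
    have hlt : lowerMass a u y < u y := by linarith
    rcases min_lt_iff.1 hlt with h | h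
    · exact absurd h (lt_irrefl _)
    · have h1 := (le_max_left 0 (a - weightBelow u y)).trans_lt h
      have h2 := (le_max_right 0 (a - weightBelow u y)).trans_lt h
      exact ⟨h1.ne', by linarith⟩
  have htot : ∀ x y, u x ≠ 0 → u y ≠ 0 → x ≤ y ∨ y ≤ x := fun x y hx hy => hc.total hx hy
  have hmk : ∀ x y, lowerMass a u x ≠ 0 → (u - lowerMass a u) y ≠ 0 → f x ≤ g y := by
    intro x y hx hy
    obtain ⟨hx1, hx2⟩ := hmoved x hx
    obtain ⟨hy1, hy2⟩ := hkept y hy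
    -- If `y < x`, the mass below `x` includes everything up to and including `y`, so it exceeds
    -- `a`; but `x` still has mass among the lowest `a` units.
    have hxy : x ≤ y := by
      rcases htot x y hx1 hy1 with h | h
      · exact h
      · rcases h.eq_or_lt with h | h
        · exact h.ge
        · have := weightBelow_add_le_of_lt hu h
          linarith
    exact (hf x y hx1 hy1 hxy).trans (hfg y hy1)
  have hsupp : ∀ z, slide f g a u z ≠ 0 → (∃ x, lowerMass a u x ≠ 0 ∧ f x = z) ∨
      ∃ y, (u - lowerMass a u) y ≠ 0 ∧ g y = z := by
    intro z hz
    by_cases h : pushforward f (lowerMass a u) z = 0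
    · right
      refine exists_of_pushforward_ne_zero fun h' => hz ?_
      simp [slide, h, h']
    · exact Or.inl (exists_of_pushforward_ne_zero h)
  refine ⟨fun z => add_nonneg (pushforward_nonneg hm0 z) (pushforward_nonneg hm1 z), ?_, ?_⟩
  · intro z hz z' hz' _
    rcases hsupp z hz with ⟨x, hx, rfl⟩ | ⟨x, hx, rfl⟩ <;>
    rcases hsupp z' hz' with ⟨y, hy, rfl⟩ | ⟨y, hy, rfl⟩
    · have hx' := (hmoved x hx).1
      have hy' := (hmoved y hy).1
      exact (htot x y hx' hy').imp (hf x y hx' hy') (hf y x hy' hx')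
    · exact Or.inl (hmk x y hx hy)
    · exact Or.inr (hmk y x hy hx)
    · have hx' := (hkept x hx).1
      have hy' := (hkept y hy).1
      exact (htot x y hx' hy').imp (hg x y hx' hy') (hg y x hy' hx')
  · intro z hz
    rcases hsupp z hz with ⟨x, hx, rfl⟩ | ⟨x, hx, rfl⟩
    · exact hfs x (hmoved x hx).1
    · exact hgs x (hkept x hx).1

end Slide

/-- The nondecreasing retraction of `ℝ` onto `[0, 1]`. -/
def ramp (x : ℝ) : ℝ := max 0 (min 1 x)

theorem ramp_of_nonpos {x : ℝ} (hx : x ≤ 0) : ramp x = 0 :=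
  max_eq_left (min_le_of_right_le hx)

theorem ramp_of_one_le {x : ℝ} (hx : 1 ≤ x) : ramp x = 1 := by
  simp [ramp, min_eq_left hx]

@[fun_prop]
theorem continuous_ramp : Continuous ramp := by
  unfold ramp
  fun_prop

/-- The path from the weight `u` to the weight concentrated in `e` that is determined by maps with
`f x ≤ x`, `f x ≤ g x` and `e ≤ g x`. -/
def contract (f g : α → α) (e : α) (τ : ℝ) (u : α → ℝ) : α → ℝ :=
  slide f id (ramp (3 * τ)) u + (slide f g (1 - ramp (3 * τ - 1)) u - pushforward f u)
    + (slide (fun _ => e) g (ramp (3 * τ - 2)) u - pushforward g u)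

/-- The three legs (identity to `f`, `f` to `g`, `g` to the constant `e`) are added up with the
intermediate endpoints subtracted, so continuity needs no gluing of cases. -/
theorem continuous_contract {Y : Type*} [TopologicalSpace Y] (f g : α → α) (e : α) {τ : Y → ℝ}
    {u : Y → α → ℝ} (hτ : Continuous τ) (hu : Continuous u) :
    Continuous fun y => contract f g e (τ y) (u y) := by
  unfold contract
  refine ((continuous_slide _ _ (by fun_prop) hu).add ((continuous_slide _ _ (by fun_prop) hu).sub
    (continuous_pushforward f hu))).add ((continuous_slide _ _ (by fun_prop) hu).sub
    (continuous_pushforward g hu))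

theorem sum_contract (f g : α → α) (e : α) (τ : ℝ) (u : α → ℝ) :
    ∑ z, contract f g e τ u z = ∑ x, u x := by
  simp [contract, Finset.sum_add_distrib, sum_slide, sum_pushforward]

/-! ### The three legs of the contraction. -/

section Contract

variable {f g : α → α} {e : α} {τ : ℝ} {u : α → ℝ} {s : Set α}

theorem contract_of_le (hu : ∀ x, 0 ≤ u x) (hs : ∑ x, u x ≤ 1) (hτ : 3 * τ ≤ 1) :
    contract f g e τ u = slide f id (ramp (3 * τ)) u := by
  simp [contract, ramp_of_nonpos (show 3 * τ - 1 ≤ 0 by linarith),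
    ramp_of_nonpos (show 3 * τ - 2 ≤ 0 by linarith), slide_zero hu, slide_one hu hs]

theorem contract_of_mem (hu : ∀ x, 0 ≤ u x) (hs : ∑ x, u x ≤ 1) (hτ : 1 ≤ 3 * τ)
    (hτ' : 3 * τ ≤ 2) : contract f g e τ u = slide f g (1 - ramp (3 * τ - 1)) u := by
  simp [contract, ramp_of_one_le hτ,
    ramp_of_nonpos (show 3 * τ - 2 ≤ 0 by linarith), slide_zero hu, slide_one hu hs]

theorem contract_of_ge (hu : ∀ x, 0 ≤ u x) (hs : ∑ x, u x ≤ 1) (hτ : 2 ≤ 3 * τ) :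
    contract f g e τ u = slide (fun _ => e) g (ramp (3 * τ - 2)) u := by
  simp [contract, ramp_of_one_le (show 1 ≤ 3 * τ by linarith),
    ramp_of_one_le (show 1 ≤ 3 * τ - 1 by linarith), slide_zero hu, slide_one hu hs]

theorem contract_zero (hu : ∀ x, 0 ≤ u x) (hs : ∑ x, u x ≤ 1) : contract f g e 0 u = u := by
  rw [contract_of_le hu hs (by norm_num), mul_zero, ramp_of_nonpos le_rfl, slide_zero hu,
    pushforward_id]

theorem contract_one [DecidableEq α] (hu : ∀ x, 0 ≤ u x) (hs : ∑ x, u x ≤ 1) :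
    contract f g e 1 u = Pi.single e (∑ x, u x) := by
  rw [contract_of_ge hu hs (by norm_num), ramp_of_one_le (by norm_num), slide_one hu hs,
    pushforward_const]

/-- On each third of the time interval the ramps of the other two legs are constant and their terms
cancel, leaving a single slide between comparable maps. -/
theorem isChainWeight_contract (hu : IsChainWeight s u) (hs : ∑ x, u x ≤ 1)
    (hf : ∀ x ∈ s, ∀ y ∈ s, x ≤ y → f x ≤ f y) (hg : ∀ x ∈ s, ∀ y ∈ s, x ≤ y → g x ≤ g y)
    (hfi : ∀ x ∈ s, f x ≤ x) (hfg : ∀ x ∈ s, f x ≤ g x) (heg : ∀ x ∈ s, e ≤ g x)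
    (hfs : ∀ x ∈ s, f x ∈ s) (hgs : ∀ x ∈ s, g x ∈ s) (hes : e ∈ s) :
    IsChainWeight s (contract f g e τ u) := by
  have hm := hu.mem
  rcases le_total (3 * τ) 1 with h1 | h1
  · rw [contract_of_le hu.nonneg hs h1]
    exact isChainWeight_slide hu.nonneg hu.isChain (fun x y hx hy => hf x (hm x hx) y (hm y hy))
      (fun x y _ _ h => h) (fun x hx => hfi x (hm x hx)) (fun x hx => hfs x (hm x hx)) hm
  rcases le_total (3 * τ) 2 with h2 | h2
  · rw [contract_of_mem hu.nonneg hs h1 h2]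
    exact isChainWeight_slide hu.nonneg hu.isChain (fun x y hx hy => hf x (hm x hx) y (hm y hy))
      (fun x y hx hy => hg x (hm x hx) y (hm y hy)) (fun x hx => hfg x (hm x hx))
      (fun x hx => hfs x (hm x hx)) (fun x hx => hgs x (hm x hx))
  · rw [contract_of_ge hu.nonneg hs h2]
    exact isChainWeight_slide hu.nonneg hu.isChain (fun _ _ _ _ _ => le_rfl)
      (fun x y hx hy => hg x (hm x hx) y (hm y hy)) (fun x hx => heg x (hm x hx))
      (fun _ _ => hes) (fun x hx => hgs x (hm x hx))

end Contract

/-! ### Equivariance -/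

section Translate

variable {H : Type*} [Group H] [MulAction H α]

/-- The translateWeight of a weight by a group element. -/
def translateWeight (h : H) (u : α → ℝ) : α → ℝ := fun x => u (h⁻¹ • x)

theorem pushforward_translateWeight {α β : Type*} [Fintype α] [MulAction H α] [MulAction H β] {h : H} {f f' : α → β} {u : α → ℝ}
    (hf : ∀ x, u x ≠ 0 → f' (h • x) = h • f x) :
    pushforward f' (translateWeight h u) = fun z => pushforward f u (h⁻¹ • z) := by
  classical
  ext z
  simp only [pushforward]
  rw [← Equiv.sum_comp (MulAction.toPerm h)]
  refine Finset.sum_congr rfl fun x _ => ?_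
  by_cases hx : u x = 0
  · simp [translateWeight, hx]
  · simp [translateWeight, MulAction.toPerm_apply, hf x hx, smul_eq_iff_eq_inv_smul]

variable [CovariantClass H α (· • ·) (· ≤ ·)]

theorem lowerMass_translateWeight (h : H) (a : ℝ) (u : α → ℝ) :
    lowerMass a (translateWeight h u) = translateWeight h (lowerMass a u) := by
  classical
  ext x
  have : weightBelow (translateWeight h u) x = weightBelow u (h⁻¹ • x) := by
    simp only [weightBelow]
    rw [← Equiv.sum_comp (MulAction.toPerm h)]
    refine Finset.sum_congr rfl fun y _ => ?_
    have e : h • y < x ↔ y < h⁻¹ • x := by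
      conv_lhs => rw [← smul_inv_smul h x]
      exact smul_lt_smul_iff_of_covariant
    simp [translateWeight, MulAction.toPerm_apply, e]
  simp [lowerMass, this, translateWeight]

theorem slide_translateWeight {h : H} {f f' g g' : α → α} {u : α → ℝ}
    (hf : ∀ x, u x ≠ 0 → f' (h • x) = h • f x) (hg : ∀ x, u x ≠ 0 → g' (h • x) = h • g x)
    (a : ℝ) : slide f' g' a (translateWeight h u) = translateWeight h (slide f g a u) := by
  have e : translateWeight h u - lowerMass a (translateWeight h u) = translateWeight h (u - lowerMass a u) := by
    rw [lowerMass_translateWeight]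
    rfl
  have h0 : ∀ x, u x = 0 → lowerMass a u x = 0 := fun x hx => by simp [lowerMass, hx]
  rw [slide, e, lowerMass_translateWeight,
    pushforward_translateWeight (f := f) fun x hx => hf x fun h => hx (h0 x h),
    pushforward_translateWeight (f := g) fun x hx => hg x fun h => hx (by simp [h0 x h, h])]
  rfl

theorem contract_translateWeight {h : H} {f f' g g' : α → α} {e : α} {u : α → ℝ}
    (hf : ∀ x, u x ≠ 0 → f' (h • x) = h • f x) (hg : ∀ x, u x ≠ 0 → g' (h • x) = h • g x)
    (τ : ℝ) : contract f' g' (h • e) τ (translateWeight h u) = translateWeight h (contract f g e τ u) := by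
  rw [contract, slide_translateWeight (g := id) hf fun _ _ => rfl, slide_translateWeight hf hg,
    slide_translateWeight (f := fun _ => e) (fun _ _ => rfl) hg, pushforward_translateWeight hf,
    pushforward_translateWeight hg]
  rfl

end Translate

end Weights

/-! ### Deformations of order complexes -/

namespace OrderComplex

variable {α β : Type*} [PartialOrder α] [Fintype α] [PartialOrder β] [Fintype β]

theorem sum_eq_one (u : OrderComplex α) : ∑ a, u.1 a = 1 :=
  (finsum_eq_sum_of_fintype u.1).symm.trans u.2.2.1

theorem continuous_val : Continuous fun u : OrderComplex α => u.1 := continuous_subtype_val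

theorem isChainWeight (u : OrderComplex α) : IsChainWeight Set.univ u.1 :=
  ⟨u.2.1, u.2.2.2, fun _ _ => trivial⟩

/-- The point of the order complex with the given barycentric coordinates. -/
def ofWeight {s : Set α} (u : α → ℝ) (hu : IsChainWeight s u) (hs : ∑ a, u a = 1) :
    OrderComplex α :=
  ⟨u, hu.nonneg, (finsum_eq_sum_of_fintype u).trans hs, hu.isChain⟩

/-- The map of order complexes induced by a monotone map. -/
def map (f : α → β) (hf : Monotone f) (u : OrderComplex α) : OrderComplex β :=
  ofWeight (s := Set.univ) (pushforward f u.1)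
    ⟨pushforward_nonneg u.2.1, by
      intro z hz z' hz' _
      obtain ⟨x, hx, rfl⟩ := exists_of_pushforward_ne_zero hz
      obtain ⟨y, hy, rfl⟩ := exists_of_pushforward_ne_zero hz'
      exact (u.2.2.2.total hx hy).imp (fun h => hf h) (fun h => hf h), fun _ _ => trivial⟩
    ((sum_pushforward f u.1).trans u.sum_eq_one)

/-- Reading off the coordinates at the points `f x` is a continuous recovery of the original weight.
-/
theorem isEmbedding_map {f : α → β} (hf : Monotone f) (hinj : Function.Injective f) :
    Topology.IsEmbedding (map f hf) := by
  have hval : Topology.IsEmbedding fun u : OrderComplex α => u.1 := Topology.IsEmbedding.subtypeVal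
  have hc : Continuous (map f hf) :=
    (continuous_pushforward f continuous_val).subtype_mk _
  have hres : Continuous fun v : OrderComplex β => fun x => v.1 (f x) :=
    continuous_pi fun x => (continuous_apply (f x)).comp continuous_val
  have hcomp : (fun v : OrderComplex β => fun x => v.1 (f x)) ∘ map f hf = fun u => u.1 := by
    ext u x
    exact pushforward_apply_of_injective hinj u.1 x
  exact Topology.IsEmbedding.of_comp hc hres (hcomp ▸ hval)

theorem map_smul {H : Type*} [Group H] [MulAction H α] [CovariantClass H α (· • ·) (· ≤ ·)]
    [MulAction H β] [CovariantClass H β (· • ·) (· ≤ ·)] {f : α → β} {hf : Monotone f}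
    (hH : ∀ (h : H) x, f (h • x) = h • f x) (h : H) (u : OrderComplex α) :
    map f hf (h • u) = h • map f hf u :=
  Subtype.ext (pushforward_translateWeight fun x _ => hH h x)

theorem mem_range_map {f : α → β} (hf : Monotone f) (hle : ∀ x y, f x ≤ f y → x ≤ y)
    {v : OrderComplex β} (hv : ∀ z, v.1 z ≠ 0 → z ∈ Set.range f) : v ∈ Set.range (map f hf) := by
  have hinj : Function.Injective f := fun x y h => le_antisymm (hle _ _ h.le) (hle _ _ h.ge)
  have hpush : pushforward f (fun x => v.1 (f x)) = v.1 := by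
    ext z
    by_cases hz : z ∈ Set.range f
    · obtain ⟨x, rfl⟩ := hz
      exact pushforward_apply_of_injective hinj _ x
    · rw [of_not_not (mt (hv z) hz)]
      by_contra h
      obtain ⟨x, -, rfl⟩ := exists_of_pushforward_ne_zero h
      exact hz ⟨x, rfl⟩
  refine ⟨ofWeight (s := Set.univ) (fun x => v.1 (f x)) ⟨fun x => v.2.1 _, fun x hx y hy hxy => ?_,
    fun _ _ => trivial⟩ ?_, Subtype.ext hpush⟩
  · exact (v.2.2.2.total hx hy).imp (hle _ _) (hle _ _)
  · rw [← sum_pushforward f, hpush, v.sum_eq_one]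

variable {H : Type*} [Group H] [MulAction H α] [CovariantClass H α (· • ·) (· ≤ ·)]
  [MulAction H β] [CovariantClass H β (· • ·) (· ≤ ·)]

/-- The points of the order complex whose support is contained in `s`. -/
def supported (s : Set α) : Set (OrderComplex α) := {u | ∀ x, u.1 x ≠ 0 → x ∈ s}

theorem equivariantlyHomotopyEquivalent_of_deformsInto {f : β → α}
    (hle : ∀ x y, f x ≤ f y ↔ x ≤ y) (hH : ∀ (h : H) x, f (h • x) = h • f x)
    (hdef : EquivariantlyDeformsInto H (supported (Set.range f))) :
    EquivariantlyHomotopyEquivalent H (OrderComplex α) (OrderComplex β) := by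
  have hf : Monotone f := fun x y h => (hle x y).2 h
  have hinj : Function.Injective f := fun x y h =>
    le_antisymm ((hle _ _).1 h.le) ((hle _ _).1 h.ge)
  refine EquivariantlyDeformsInto.equivariantlyHomotopyEquivalent (isEmbedding_map hf hinj)
    (fun h y => map_smul hH h y) ?_
  convert hdef
  ext v
  refine ⟨?_, fun hv => mem_range_map hf (fun x y => (hle x y).1) hv⟩
  rintro ⟨u, rfl⟩ z hz
  obtain ⟨x, -, rfl⟩ := exists_of_pushforward_ne_zero hz
  exact ⟨x, rfl⟩

/-- An order complex deforms along a decreasing map onto the set of its fixed points. -/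
theorem deformsInto_of_le_id {r : α → α} {s : Set α} (hr : Monotone r) (hle : ∀ x, r x ≤ x)
    (hrs : ∀ x, r x ∈ s) (hfix : ∀ x ∈ s, r x = x) (hH : ∀ (h : H) x, r (h • x) = h • r x) :
    EquivariantlyDeformsInto H (supported s) := by
  have hw : ∀ (t : I) (u : OrderComplex α),
      IsChainWeight Set.univ (slide r id (t : ℝ) u.1) := fun t u =>
    isChainWeight_slide u.2.1 u.2.2.2 (fun x y _ _ h => hr h) (fun x y _ _ h => h)
      (fun x _ => hle x) (fun _ _ => trivial) (fun _ _ => trivial)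
  refine ⟨fun q => ofWeight _ (hw q.1 q.2) ((sum_slide r id _ _).trans q.2.sum_eq_one), ?_, ?_, ?_,
    ?_, ?_⟩
  · exact (continuous_slide r id (continuous_subtype_val.comp continuous_fst)
      (continuous_val.comp continuous_snd)).subtype_mk _
  · intro u
    refine Subtype.ext ?_
    change slide r id ((0 : I) : ℝ) u.1 = u.1
    rw [Set.Icc.coe_zero, slide_zero u.2.1, pushforward_id]
  · intro u z hz
    change slide r id ((1 : I) : ℝ) u.1 z ≠ 0 at hz
    rw [Set.Icc.coe_one, slide_one u.2.1 u.sum_eq_one.le] at hz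
    obtain ⟨x, -, rfl⟩ := exists_of_pushforward_ne_zero hz
    exact hrs x
  · intro t u hu
    exact Subtype.ext (slide_self_id fun x hx => hfix x (hu x hx))
  · intro h t u
    exact Subtype.ext (slide_translateWeight (f := r) (g := id) (fun x _ => hH h x)
      (fun _ _ => rfl) (t : ℝ))

end OrderComplex

/-- Both deformations run simultaneously, the second applied to the result of the first. Since the
second one preserves `A`, the endpoint reached in `A` stays there. -/
theorem EquivariantlyDeformsInto.inter {H X : Type*} [Group H] [TopologicalSpace X] [MulAction H X]
    {A B : Set X} (hA : EquivariantlyDeformsInto H A)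
    (hB : ∃ F : I × X → X, Continuous F ∧ (∀ x, F (0, x) = x) ∧ (∀ x, F (1, x) ∈ B) ∧
      (∀ t, ∀ x ∈ B, F (t, x) = x) ∧ (∀ (h : H) (t : I) (x : X), F (t, h • x) = h • F (t, x)) ∧
      ∀ t, ∀ x ∈ A, F (t, x) ∈ A) :
    EquivariantlyDeformsInto H (A ∩ B) := by
  obtain ⟨F, hF, hF0, hF1, hFA, hFH⟩ := hA
  obtain ⟨F', hF', hF0', hF1', hFB, hFH', hpres⟩ := hB
  refine ⟨fun q => F' (q.1, F q), by fun_prop, fun x => by simp [hF0, hF0'],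
    fun x => ⟨hpres _ _ (hF1 x), hF1' _⟩, fun t x hx => ?_, fun h t x => ?_⟩
  · simp only [hFA t x hx.1, hFB t x hx.2]
  · simp only [hFH, hFH']

/-! ### Removing elements with conically contractible upper links -/

section PushOff

variable {α : Type*} [PartialOrder α]

/-- For each `w ∈ W`, the elements above `w` are contracted to `e w` through
`x ≥ f w x ≤ g w x ≥ e w`. -/
structure ContractsAbove (W : Set α) (f g : α → α → α) (e : α → α) : Prop where
  lt_f : ∀ w ∈ W, ∀ x, w < x → w < f w x
  lt_g : ∀ w ∈ W, ∀ x, w < x → w < g w x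
  lt_e : ∀ w ∈ W, w < e w
  monotone_f : ∀ w ∈ W, ∀ x y, w < x → x ≤ y → f w x ≤ f w y
  monotone_g : ∀ w ∈ W, ∀ x y, w < x → x ≤ y → g w x ≤ g w y
  f_le : ∀ w ∈ W, ∀ x, w < x → f w x ≤ x
  f_le_g : ∀ w ∈ W, ∀ x, w < x → f w x ≤ g w x
  e_le_g : ∀ w ∈ W, ∀ x, w < x → e w ≤ g w x

theorem ContractsAbove.mono {W W' : Set α} {f g : α → α → α} {e : α → α}
    (h : ContractsAbove W f g e) (hW : W' ⊆ W) : ContractsAbove W' f g e where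
  lt_f w hw := h.lt_f w (hW hw)
  lt_g w hw := h.lt_g w (hW hw)
  lt_e w hw := h.lt_e w (hW hw)
  monotone_f w hw := h.monotone_f w (hW hw)
  monotone_g w hw := h.monotone_g w (hW hw)
  f_le w hw := h.f_le w (hW hw)
  f_le_g w hw := h.f_le_g w (hW hw)
  e_le_g w hw := h.e_le_g w (hW hw)

open Classical in
/-- The restriction of a weight to the elements above `w`. -/
def above (w : α) (u : α → ℝ) : α → ℝ := fun x => if w < x then u x else 0

theorem isChainWeight_above {u : α → ℝ} (hu : IsChainWeight Set.univ u) (w : α) :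
    IsChainWeight (Set.Ioi w) (above w u) := by
  have h : ∀ x, above w u x ≠ 0 → w < x ∧ u x ≠ 0 := fun x hx => by
    unfold above at hx
    split_ifs at hx with hwx
    · exact ⟨hwx, hx⟩
    · exact absurd rfl hx
  refine ⟨fun x => ?_, fun x hx y hy hxy => hu.isChain (h x hx).2 (h y hy).2 hxy,
    fun x hx => (h x hx).1⟩
  unfold above
  split_ifs
  · exact hu.nonneg x
  · exact le_rfl

variable [Fintype α] {W : Set α} {f g : α → α → α} {e : α → α}

open Classical in
/-- The weight to which the part of `u` above `w` is moved at time `t`. -/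
def moved (f g : α → α → α) (e : α → α) (t : ℝ) (u : α → ℝ) (w : α) : α → ℝ :=
  contract (f w) (g w) (e w) (min 1 (2 * (t * u w))) (above w u)
    + Pi.single (e w) (max 0 (2 * (t * u w) - 1))

open Classical in
/-- At time `t`, the proportion `t` of the weights of the elements of `W` is removed. -/
def pushOff (W : Set α) (f g : α → α → α) (e : α → α) (t : ℝ) (u : α → ℝ) : α → ℝ :=
  u + ∑ w, if w ∈ W then moved f g e t u w - above w u - Pi.single w (t * u w) else 0

theorem continuous_pushOff (W : Set α) (f g : α → α → α) (e : α → α) {Y : Type*}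
    [TopologicalSpace Y] {t : Y → ℝ} {u : Y → α → ℝ} (ht : Continuous t) (hu : Continuous u) :
    Continuous fun y => pushOff W f g e (t y) (u y) := by
  classical
  refine hu.add (continuous_finsetSum _ fun w _ => ?_)
  split_ifs
  · have ha : Continuous fun y => above w (u y) := by
      refine continuous_pi fun x => ?_
      unfold above
      split_ifs
      · fun_prop
      · exact continuous_const
    have hs : ∀ (a : α) (c : Y → ℝ), Continuous c →
        Continuous fun y => (Pi.single a (c y) : α → ℝ) := fun a c hc =>
      (continuous_single (A := fun _ : α => ℝ) a).comp hc
    exact (((continuous_contract _ _ _ (by fun_prop) ha).add (hs _ _ (by fun_prop))).sub ha).sub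
      (hs _ _ (by fun_prop))
  · exact continuous_const

variable (u : OrderComplex α)

theorem sum_above_le_one (w : α) : ∑ x, above w u.1 x ≤ 1 := by
  refine le_trans (Finset.sum_le_sum fun x _ => ?_) u.sum_eq_one.le
  unfold above
  split_ifs
  · exact le_rfl
  · exact u.2.1 x

theorem pushOff_of_supported (hu : u ∈ OrderComplex.supported Wᶜ) (t : ℝ) :
    pushOff W f g e t u.1 = u.1 := by
  classical
  unfold pushOff
  rw [Finset.sum_eq_zero, add_zero]
  intro w _
  split_ifs with hw
  · have h0 : u.1 w = 0 := by
      by_contra h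
      exact hu w h hw
    rw [moved, h0, mul_zero, mul_zero, min_eq_right zero_le_one,
      contract_zero (isChainWeight_above u.isChainWeight w).nonneg (sum_above_le_one u w)]
    simp
  · rfl

-- The support of `u` is a chain and meets the antichain `W` at most once. Every other summand has
-- contraction time `0` and no weight to remove, so it vanishes.
open Classical in
theorem pushOff_of_mem (hW : IsAntichain (· ≤ ·) W) {w : α} (hw : w ∈ W) (huw : u.1 w ≠ 0)
    (t : ℝ) :
    pushOff W f g e t u.1 = u.1 + (moved f g e t u.1 w - above w u.1 - Pi.single w (t * u.1 w)) := by
  classical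
  unfold pushOff
  rw [Finset.sum_eq_single w, if_pos hw]
  · intro w' _ hne
    split_ifs with hw'
    · have h0 : u.1 w' = 0 := by
        by_contra h
        rcases u.2.2.2.total h huw with h1 | h1
        · exact hW hw' hw hne h1
        · exact hW hw hw' hne.symm h1
      rw [moved, h0, mul_zero, mul_zero, min_eq_right zero_le_one,
        contract_zero (isChainWeight_above u.isChainWeight w').nonneg (sum_above_le_one u w')]
      simp
    · rfl
  · simp

/-- New weight may be placed on `e w` only when the part above `w` is already concentrated there, or
the support could fail to be a chain. The contraction therefore finishes when the removed weight `t
* u w` reaches `1 / 2`, and only then does the extra mass appear. -/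
theorem isChainWeight_moved (hc : ContractsAbove W f g e) {w : α} (hw : w ∈ W) (t : ℝ) :
    IsChainWeight (Set.Ioi w) (moved f g e t u.1 w) := by
  classical
  have ha := isChainWeight_above u.isChainWeight w
  have hs := sum_above_le_one u w
  unfold moved
  rcases le_total (2 * (t * u.1 w)) 1 with h | h
  · rw [max_eq_left (by linarith), Pi.single_zero, add_zero]
    exact isChainWeight_contract ha hs (fun x hx y _ => hc.monotone_f w hw x y hx)
      (fun x hx y _ => hc.monotone_g w hw x y hx) (hc.f_le w hw) (hc.f_le_g w hw)
      (hc.e_le_g w hw) (hc.lt_f w hw) (hc.lt_g w hw) (hc.lt_e w hw)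
  · rw [min_eq_left h, contract_one ha.nonneg hs]
    have hmem : ∀ x, (Pi.single (e w) (∑ x, above w u.1 x) +
        Pi.single (e w) (max 0 (2 * (t * u.1 w) - 1)) : α → ℝ) x ≠ 0 → x = e w := by
      intro x hx
      by_contra hne
      simp [Pi.single_eq_of_ne hne] at hx
    refine ⟨fun x => ?_, fun x hx y hy hxy => ?_, fun x hx => ?_⟩
    · have h1 : 0 ≤ ∑ x, above w u.1 x := Finset.sum_nonneg fun x _ => ha.nonneg x
      have h2 : 0 ≤ max 0 (2 * (t * u.1 w) - 1) := le_max_left _ _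
      by_cases hx : x = e w
      · subst hx
        simpa using add_nonneg h1 h2
      · simp [Pi.single_eq_of_ne hx]
    · exact absurd ((hmem x hx).trans (hmem y hy).symm) hxy
    · rw [hmem x hx]
      exact hc.lt_e w hw

theorem pushOff_apply (hc : ContractsAbove W f g e) (hW : IsAntichain (· ≤ ·) W) {w : α}
    (hw : w ∈ W) (huw : u.1 w ≠ 0) (t : ℝ) (x : α) :
    (w < x → pushOff W f g e t u.1 x = moved f g e t u.1 w x) ∧
    (pushOff W f g e t u.1 w = (1 - t) * u.1 w) ∧
    (x ≠ w → ¬ w < x → pushOff W f g e t u.1 x = u.1 x) := by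
  classical
  have hm : ∀ x, ¬ w < x → moved f g e t u.1 w x = 0 := fun x hx => by
    by_contra h
    exact hx ((isChainWeight_moved u hc hw t).mem x h)
  rw [pushOff_of_mem u hW hw huw]
  refine ⟨fun hx => ?_, ?_, fun hne hx => ?_⟩
  · simp [above, hx, Pi.single_eq_of_ne hx.ne']
  · simp [above, hm w (lt_irrefl w)]
    ring
  · simp [above, hx, hm x hx, Pi.single_eq_of_ne hne]

theorem pushOff_ne_zero (hc : ContractsAbove W f g e) (hW : IsAntichain (· ≤ ·) W) (t : ℝ) {x : α}
    (hx : pushOff W f g e t u.1 x ≠ 0) : u.1 x ≠ 0 ∨ ∃ w ∈ W, w < x := by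
  classical
  by_cases hu : u ∈ OrderComplex.supported Wᶜ
  · rw [pushOff_of_supported u hu] at hx
    exact Or.inl hx
  · simp only [OrderComplex.supported, Set.mem_ofPred_eq, not_forall, Set.mem_compl_iff,
      not_not] at hu
    obtain ⟨w, huw, hw⟩ := hu
    by_cases hwx : w < x
    · exact Or.inr ⟨w, hw, hwx⟩
    · left
      by_cases hxw : x = w
      · exact hxw ▸ huw
      · rwa [(pushOff_apply u hc hW hw huw t x).2.2 hxw hwx] at hx

/-- Up to `w` the support stays inside the old chain, and all that changes above it is a chain in
`Set.Ioi w`; the two pieces are comparable through `w`. -/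
theorem isChainWeight_pushOff (hc : ContractsAbove W f g e) (hW : IsAntichain (· ≤ ·) W) (t : I) :
    IsChainWeight Set.univ (pushOff W f g e t u.1) := by
  classical
  by_cases hu : u ∈ OrderComplex.supported Wᶜ
  · rw [pushOff_of_supported u hu]
    exact u.isChainWeight
  · simp only [OrderComplex.supported, Set.mem_ofPred_eq, not_forall, Set.mem_compl_iff,
      not_not] at hu
    obtain ⟨w, huw, hw⟩ := hu
    have hm := isChainWeight_moved u hc hw t
    have happ := pushOff_apply u hc hW hw huw (t : ℝ)
    have hlow : ∀ x, pushOff W f g e t u.1 x ≠ 0 → ¬ w < x → u.1 x ≠ 0 ∧ x ≤ w := by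
      intro x hx hwx
      have hux : u.1 x ≠ 0 := by
        by_cases hxw : x = w
        · exact hxw ▸ huw
        · rwa [(happ x).2.2 hxw hwx] at hx
      refine ⟨hux, ?_⟩
      rcases u.2.2.2.total hux huw with h | h
      · exact h
      · exact (h.eq_or_lt.resolve_right hwx).ge
    refine ⟨fun x => ?_, fun x hx y hy hxy => ?_, fun _ _ => trivial⟩
    · by_cases hwx : w < x
      · rw [(happ x).1 hwx]
        exact hm.nonneg x
      · by_cases hxw : x = w
        · subst hxw
          rw [(happ x).2.1]
          exact mul_nonneg (by linarith [t.2.2]) (u.2.1 x)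
        · rw [(happ x).2.2 hxw hwx]
          exact u.2.1 x
    · by_cases hwx : w < x <;> by_cases hwy : w < y
      · rw [Function.mem_support, (happ _).1 ‹_›] at hx hy
        exact hm.isChain hx hy hxy
      · exact Or.inr ((hlow y hy hwy).2.trans hwx.le)
      · exact Or.inl ((hlow x hx hwx).2.trans hwy.le)
      · exact u.2.2.2 (hlow x hx hwx).1 (hlow y hy hwy).1 hxy

/-- With `s = t * u w` the total is `1 - s` for `s ≤ 1 / 2` and `s` afterwards. The mass added at `e
w` is needed because there may be no weight above `w` at all; the bound makes normalization
continuous. -/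
theorem half_le_sum_pushOff (hW : IsAntichain (· ≤ ·) W) (t : I) :
    1 / 2 ≤ ∑ x, pushOff W f g e t u.1 x := by
  classical
  by_cases hu : u ∈ OrderComplex.supported Wᶜ
  · rw [pushOff_of_supported u hu, u.sum_eq_one]
    norm_num
  · simp only [OrderComplex.supported, Set.mem_ofPred_eq, not_forall, Set.mem_compl_iff,
      not_not] at hu
    obtain ⟨w, huw, hw⟩ := hu
    have hsum : ∑ x, pushOff W f g e t u.1 x =
        1 + (max 0 (2 * (t * u.1 w) - 1) - t * u.1 w) := by
      rw [pushOff_of_mem u hW hw huw]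
      simp [moved, Finset.sum_add_distrib, Finset.sum_sub_distrib, sum_contract, u.sum_eq_one]
    rw [hsum]
    rcases le_total (2 * (t * u.1 w)) 1 with h | h
    · linarith [le_max_left 0 (2 * (t * u.1 w) - 1)]
    · linarith [le_max_right 0 (2 * (t * u.1 w) - 1)]

/-- Weight is only pushed strictly above an element of `W`, hence never onto another element of the
antichain, and at time `1` the old weight on `W` is gone. -/
theorem pushOff_one_apply (hc : ContractsAbove W f g e) (hW : IsAntichain (· ≤ ·) W) {x : α}
    (hx : x ∈ W) : pushOff W f g e 1 u.1 x = 0 := by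
  classical
  by_contra h
  by_cases hux : u.1 x = 0
  · obtain h | ⟨w, hw, hwx⟩ := pushOff_ne_zero u hc hW 1 h
    · exact h hux
    · exact hW hw hx hwx.ne hwx.le
  · refine h ?_
    rw [(pushOff_apply u hc hW hx hux 1 x).2.1]
    simp

section Equivariance

variable {H : Type*} [Group H] [MulAction H α] [CovariantClass H α (· • ·) (· ≤ ·)]

theorem pushOff_translateWeight (hWH : ∀ (h : H) w, w ∈ W → h • w ∈ W)
    (hf : ∀ (h : H), ∀ w ∈ W, ∀ x, w < x → f (h • w) (h • x) = h • f w x)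
    (hg : ∀ (h : H), ∀ w ∈ W, ∀ x, w < x → g (h • w) (h • x) = h • g w x)
    (he : ∀ (h : H), ∀ w ∈ W, e (h • w) = h • e w) (h : H) (t : ℝ) :
    pushOff W f g e t (translateWeight h u.1) = translateWeight h (pushOff W f g e t u.1) := by
  classical
  have hsingle : ∀ (a : α) (c : ℝ), (Pi.single (h • a) c : α → ℝ) =
      translateWeight h (Pi.single a c) := fun a c => by
    ext x
    simp [translateWeight, Pi.single_apply, inv_smul_eq_iff]
  have habove : ∀ w, above (h • w) (translateWeight h u.1) = translateWeight h (above w u.1) := by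
    intro w
    ext x
    have : h • w < x ↔ w < h⁻¹ • x := by
      conv_lhs => rw [← smul_inv_smul h x]
      exact smul_lt_smul_iff_of_covariant
    simp [above, translateWeight, this]
  have hval : ∀ w, translateWeight h u.1 (h • w) = u.1 w := fun w => by simp [translateWeight]
  have hmoved : ∀ w ∈ W, moved f g e t (translateWeight h u.1) (h • w) =
      translateWeight h (moved f g e t u.1 w) := by
    intro w hw
    unfold moved
    have hmem := (isChainWeight_above u.isChainWeight w).mem
    rw [habove, hval, he h w hw, contract_translateWeight (fun x hx => hf h w hw x (hmem x hx))
      (fun x hx => hg h w hw x (hmem x hx)), hsingle]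
    rfl
  have hterm : ∀ w, (if h • w ∈ W then moved f g e t (translateWeight h u.1) (h • w)
        - above (h • w) (translateWeight h u.1)
        - Pi.single (h • w) (t * translateWeight h u.1 (h • w)) else 0) =
      translateWeight h
        (if w ∈ W then moved f g e t u.1 w - above w u.1 - Pi.single w (t * u.1 w) else 0) := by
    intro w
    by_cases hw : w ∈ W
    · rw [if_pos (hWH h w hw), if_pos hw, hmoved w hw, habove, hval, hsingle]
      rfl
    · have hw' : h • w ∉ W := fun h' => hw (by simpa using hWH h⁻¹ _ h')
      rw [if_neg hw, if_neg hw']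
      rfl
  unfold pushOff
  rw [← Equiv.sum_comp (MulAction.toPerm h)]
  ext x
  simp only [MulAction.toPerm_apply]
  have := fun w => congrFun (hterm w) x
  simp only [Pi.add_apply, Finset.sum_apply, translateWeight] at this ⊢
  congr 1
  refine Finset.sum_congr rfl fun w _ => ?_
  convert this w using 1

end Equivariance

/-- The points whose support avoids `W` form an equivariant deformation retract. -/
theorem exists_deformation_of_contractsAbove {H : Type*} [Group H] [MulAction H α]
    [CovariantClass H α (· • ·) (· ≤ ·)] (hc : ContractsAbove W f g e)
    (hW : IsAntichain (· ≤ ·) W) (hWH : ∀ (h : H) w, w ∈ W → h • w ∈ W)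
    (hf : ∀ (h : H), ∀ w ∈ W, ∀ x, w < x → f (h • w) (h • x) = h • f w x)
    (hg : ∀ (h : H), ∀ w ∈ W, ∀ x, w < x → g (h • w) (h • x) = h • g w x)
    (he : ∀ (h : H), ∀ w ∈ W, e (h • w) = h • e w) :
    ∃ F : I × OrderComplex α → OrderComplex α, Continuous F ∧ (∀ u, F (0, u) = u) ∧
      (∀ u, F (1, u) ∈ OrderComplex.supported Wᶜ) ∧
      (∀ t, ∀ u ∈ OrderComplex.supported Wᶜ, F (t, u) = u) ∧
      (∀ (h : H) (t : I) u, F (t, h • u) = h • F (t, u)) ∧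
      ∀ t u x, (F (t, u)).1 x ≠ 0 → u.1 x ≠ 0 ∨ ∃ w ∈ W, w < x := by
  -- `pushOff` does not preserve total mass, so the deformation is its normalization.
  let total : I × OrderComplex α → ℝ := fun q => ∑ x, pushOff W f g e q.1 q.2.1 x
  have hpos : ∀ q, 0 < total q := fun q => by
    have := half_le_sum_pushOff (f := f) (g := g) (e := e) q.2 hW q.1
    simp only [total]
    linarith
  have hcw : ∀ q : I × OrderComplex α,
      IsChainWeight Set.univ ((total q)⁻¹ • pushOff W f g e q.1 q.2.1) := fun q => by
    have h := isChainWeight_pushOff q.2 hc hW q.1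
    have hne : ∀ x, ((total q)⁻¹ • pushOff W f g e q.1 q.2.1) x ≠ 0 →
        pushOff W f g e q.1 q.2.1 x ≠ 0 := fun x hx h0 => hx (by simp [h0])
    exact ⟨fun x => mul_nonneg (inv_nonneg.2 (hpos q).le) (h.nonneg x),
      fun x hx y hy hxy => h.isChain (hne x hx) (hne y hy) hxy, fun _ _ => trivial⟩
  have hsum : ∀ q : I × OrderComplex α,
      ∑ x, ((total q)⁻¹ • pushOff W f g e q.1 q.2.1) x = 1 := fun q => by
    simp only [Pi.smul_apply, smul_eq_mul, ← Finset.mul_sum]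
    exact inv_mul_cancel₀ (hpos q).ne'
  have hcont : Continuous fun q : I × OrderComplex α => pushOff W f g e q.1 q.2.1 :=
    continuous_pushOff W f g e (continuous_subtype_val.comp continuous_fst)
      (OrderComplex.continuous_val.comp continuous_snd)
  have hfix : ∀ (t : I) (u : OrderComplex α), pushOff W f g e t u.1 = u.1 →
      OrderComplex.ofWeight _ (hcw (t, u)) (hsum (t, u)) = u := fun t u h => by
    refine Subtype.ext ?_
    change (∑ x, pushOff W f g e t u.1 x)⁻¹ • pushOff W f g e t u.1 = u.1
    rw [h, u.sum_eq_one, inv_one, one_smul]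
  refine ⟨fun q => OrderComplex.ofWeight _ (hcw q) (hsum q), ?_, fun u => hfix 0 u ?_,
    fun u x hx hxW => hx ?_, fun t u hu => hfix t u (pushOff_of_supported u hu _), fun h t u => ?_,
    fun t u x hx => pushOff_ne_zero u hc hW t fun h0 => hx ?_⟩
  · exact ((Continuous.inv₀ (continuous_finsetSum _ fun x _ => (continuous_apply x).comp hcont)
      fun q => (hpos q).ne').smul hcont).subtype_mk _
  · simp only [Set.Icc.coe_zero]
    classical
    unfold pushOff
    rw [Finset.sum_eq_zero, add_zero]
    intro w _
    split_ifs
    · rw [moved, zero_mul, mul_zero, min_eq_right zero_le_one,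
        contract_zero (isChainWeight_above u.isChainWeight w).nonneg (sum_above_le_one u w)]
      simp
    · rfl
  · change _ * pushOff W f g e ((1 : I) : ℝ) u.1 x = 0
    rw [Set.Icc.coe_one, pushOff_one_apply u hc hW hxW, mul_zero]
  · refine Subtype.ext ?_
    have h1 := pushOff_translateWeight u hWH hf hg he h (t : ℝ)
    have h2 : total (t, h • u) = total (t, u) := by
      change ∑ x, pushOff W f g e t (translateWeight h u.1) x = _
      rw [h1]
      exact Equiv.sum_comp (MulAction.toPerm h⁻¹) _
    change (total (t, h • u))⁻¹ • pushOff W f g e t (translateWeight h u.1) = _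
    rw [h1, h2]
    rfl
  · change _ * pushOff W f g e t u.1 x = 0
    rw [h0, mul_zero]

/-- Removing the elements outside `A` in the order of their ranks. -/
theorem deformsInto_of_contractsAbove {H : Type*} [Group H] [MulAction H α]
    [CovariantClass H α (· • ·) (· ≤ ·)] {A : Set α} (hc : ContractsAbove Aᶜ f g e)
    (hAH : ∀ (h : H) w, w ∈ A → h • w ∈ A) {rank : α → ℕ} (hrank : StrictMono rank)
    (hrankH : ∀ (h : H) x, rank (h • x) = rank x)
    (hf : ∀ (h : H), ∀ w ∉ A, ∀ x, w < x → f (h • w) (h • x) = h • f w x)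
    (hg : ∀ (h : H), ∀ w ∉ A, ∀ x, w < x → g (h • w) (h • x) = h • g w x)
    (he : ∀ (h : H), ∀ w ∉ A, e (h • w) = h • e w) :
    EquivariantlyDeformsInto H (OrderComplex.supported A) := by
  -- Elements of equal rank form an antichain, and the deformation removing them only pushes weight
  -- to higher rank, so it brings back nothing removed earlier.
  have key : ∀ n : ℕ, EquivariantlyDeformsInto H
      (OrderComplex.supported {x : α | x ∈ A ∨ n ≤ rank x}) := by
    intro n
    induction n with
    | zero =>
      refine ⟨fun q => q.2, continuous_snd, fun _ => rfl, fun u x _ => Or.inr (Nat.zero_le _),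
        fun _ _ _ => rfl, fun _ _ _ => rfl⟩
    | succ n ih =>
      have hW : {x : α | x ∉ A ∧ rank x = n} ⊆ Aᶜ := fun x hx => hx.1
      obtain ⟨F, h1, h2, h3, h4, h5, h6⟩ := exists_deformation_of_contractsAbove (H := H)
        (hc.mono hW) (fun x hx y hy hxy hle => (hrank (lt_of_le_of_ne hle hxy)).ne
          (hx.2.trans hy.2.symm))
        (fun h w hw => ⟨fun hA => hw.1 (by simpa using hAH h⁻¹ _ hA),
          (hrankH h w).trans hw.2⟩)
        (fun h w hw => hf h w hw.1) (fun h w hw => hg h w hw.1) (fun h w hw => he h w hw.1)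
      convert ih.inter ⟨F, h1, h2, h3, h4, h5, fun t u hu x hx => ?_⟩ using 1
      · ext u
        refine ⟨fun hu => ⟨fun x hx => (hu x hx).imp_right fun h => by omega,
          fun x hx hxW => ?_⟩, fun hu x hx => ?_⟩
        · rcases hu x hx with h | h
          · exact hxW.1 h
          · have := hxW.2
            omega
        · refine (hu.1 x hx).elim Or.inl fun h => ?_
          by_cases hA : x ∈ A
          · exact Or.inl hA
          · exact Or.inr (lt_of_le_of_ne h fun h' => hu.2 x hx ⟨hA, h'.symm⟩)
      · rcases h6 t u x hx with h | ⟨w, hw, hwx⟩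
        · exact hu x h
        · exact Or.inr (hw.2 ▸ (hrank hwx).le)
  obtain ⟨N, hN⟩ := (Set.finite_range rank).bddAbove
  convert key (N + 1) using 2
  ext x
  refine ⟨Or.inl, fun h => h.resolve_right fun h' => ?_⟩
  have := hN ⟨x, rfl⟩
  omega

end PushOff

/-! ### Posets of subgroups -/

section SubgroupPosets

variable {H K α β : Type*} [Group H] [Group K] [Finite K] {ρ : H →* MulAut K}
  [PartialOrder α] [Finite α] [MulAction H α] [CovariantClass H α (· • ·) (· ≤ ·)]
  [PartialOrder β] [Finite β] [MulAction H β] [CovariantClass H β (· • ·) (· ≤ ·)]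

/-- Let `α` be a poset of subgroups and `β` an invariant subset. If each set
`{R ∈ α | P < R}`, `P ∉ β`, is conically contractible through `R ≥ f P R ≤ g P R ≥ e P`, then
`α` and `β` are equivariantly homotopy equivalent. -/
theorem equivariantlyHomotopyEquivalent_of_contractsAbove {j : α → Subgroup K}
    (hj : ∀ x y, j x ≤ j y ↔ x ≤ y) (hjH : ∀ (h : H) x, j (h • x) = ρ h • j x)
    {i : β → α} (hi : ∀ x y, i x ≤ i y ↔ x ≤ y) (hiH : ∀ (h : H) x, i (h • x) = h • i x)
    {f g : Subgroup K → Subgroup K → Subgroup K} {e : Subgroup K → Subgroup K}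
    (hf : ∀ P Q R, Q ≤ R → f P Q ≤ f P R) (hg : ∀ P Q R, Q ≤ R → g P Q ≤ g P R)
    (hfle : ∀ P Q, f P Q ≤ Q) (hfg : ∀ P Q, f P Q ≤ g P Q) (heg : ∀ P Q, e P ≤ g P Q)
    (hfH : ∀ (h : H) P Q, f (ρ h • P) (ρ h • Q) = ρ h • f P Q)
    (hgH : ∀ (h : H) P Q, g (ρ h • P) (ρ h • Q) = ρ h • g P Q)
    (heH : ∀ (h : H) P, e (ρ h • P) = ρ h • e P)
    (hfα : ∀ w ∉ Set.range i, ∀ x, w < x → j w < f (j w) (j x) ∧ f (j w) (j x) ∈ Set.range j)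
    (hgα : ∀ w ∉ Set.range i, ∀ x, w < x → g (j w) (j x) ∈ Set.range j)
    (heα : ∀ w ∉ Set.range i, j w < e (j w) ∧ e (j w) ∈ Set.range j) :
    EquivariantlyHomotopyEquivalent H (OrderComplex α) (OrderComplex β) := by
  classical
  cases nonempty_fintype α
  cases nonempty_fintype β
  have hinj : Function.Injective j := fun x y h =>
    le_antisymm ((hj _ _).1 h.le) ((hj _ _).1 h.ge)
  have hjlt : ∀ x y, j x < j y ↔ x < y := fun x y => by
    rw [lt_iff_le_not_ge, lt_iff_le_not_ge, hj, hj]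
  -- The default `x` is never relevant: `ContractsAbove` only asks about pairs for which the
  -- subgroup lies in the range of `j`.
  let lift : Subgroup K → α → α := fun P x => if h : P ∈ Set.range j then h.choose else x
  have hlift : ∀ P x, P ∈ Set.range j → j (lift P x) = P := fun P x h => by
    simp only [lift, dif_pos h]
    exact h.choose_spec
  refine OrderComplex.equivariantlyHomotopyEquivalent_of_deformsInto hi hiH
    (deformsInto_of_contractsAbove (f := fun w x => lift (f (j w) (j x)) x)
      (g := fun w x => lift (g (j w) (j x)) x) (e := fun w => lift (e (j w)) w)
      (rank := fun x => Nat.card (j x)) ?_ ?_ ?_ ?_ ?_ ?_ ?_)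
  · refine ⟨fun w hw x hx => ?_, fun w hw x hx => ?_, fun w hw => ?_, fun w hw x y hx hxy => ?_,
      fun w hw x y hx hxy => ?_, fun w hw x hx => ?_, fun w hw x hx => ?_, fun w hw x hx => ?_⟩
    · rw [← hjlt, hlift _ _ (hfα w hw x hx).2]
      exact (hfα w hw x hx).1
    · rw [← hjlt, hlift _ _ (hgα w hw x hx)]
      exact (hfα w hw x hx).1.trans_le (hfg _ _)
    · rw [← hjlt, hlift _ _ (heα w hw).2]
      exact (heα w hw).1
    · rw [← hj, hlift _ _ (hfα w hw x hx).2, hlift _ _ (hfα w hw y (hx.trans_le hxy)).2]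
      exact hf _ _ _ ((hj _ _).2 hxy)
    · rw [← hj, hlift _ _ (hgα w hw x hx), hlift _ _ (hgα w hw y (hx.trans_le hxy))]
      exact hg _ _ _ ((hj _ _).2 hxy)
    · rw [← hj, hlift _ _ (hfα w hw x hx).2]
      exact hfle _ _
    · rw [← hj, hlift _ _ (hfα w hw x hx).2, hlift _ _ (hgα w hw x hx)]
      exact hfg _ _
    · rw [← hj, hlift _ _ (heα w hw).2, hlift _ _ (hgα w hw x hx)]
      exact heg _ _
  · rintro h _ ⟨b, rfl⟩
    exact ⟨h • b, hiH h b⟩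
  · intro x y hxy
    have hle := (hjlt x y).2 hxy
    exact Set.ncard_lt_ncard (s := (j x : Set K)) (t := (j y : Set K)) hle (Set.toFinite _)
  · intro h x
    simp only [hjH]
    exact Nat.card_congr (Subgroup.equivSMul (ρ h) (j x)).symm.toEquiv
  all_goals
    have hmem : ∀ (h : H), ∀ w ∉ Set.range i, h • w ∉ Set.range i := by
      rintro h w hw ⟨b, hb⟩
      exact hw ⟨h⁻¹ • b, by rw [hiH, hb, inv_smul_smul]⟩
  · intro h w hw x hx
    apply hinj
    rw [hlift _ _ (hfα _ (hmem h w hw) _ (smul_lt_smul_iff_of_covariant.2 hx)).2, hjH, hjH, hfH,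
      hjH, hlift _ _ (hfα w hw x hx).2]
  · intro h w hw x hx
    apply hinj
    rw [hlift _ _ (hgα _ (hmem h w hw) _ (smul_lt_smul_iff_of_covariant.2 hx)), hjH, hjH, hgH,
      hjH, hlift _ _ (hgα w hw x hx)]
  · intro h w hw
    apply hinj
    rw [hlift _ _ (heα _ (hmem h w hw)).2, hjH, heH, hjH, hlift _ _ (heα w hw).2]

end SubgroupPosets

/-! ### Coprime action and groups of characteristic `p` -/

section CharacteristicP

variable {K : Type*} [Group K] {p : ℕ}

/-- Iterating gives `x ^ n * y * x ^ (-n) = y * c ^ n`; at `n = orderOf x` this kills `c ^ orderOf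
x`. It is the coprime action argument that `[x, y] = 1` once `x` commutes with this commutator. -/
theorem eq_one_of_conj_eq_mul {x y c : K} (h : x * y * x⁻¹ = y * c) (hc : Commute x c)
    (hcop : (orderOf c).Coprime (orderOf x)) : c = 1 := by
  have key : ∀ n : ℕ, x ^ n * y * (x ^ n)⁻¹ = y * c ^ n := by
    intro n
    induction n with
    | zero => simp
    | succ n ih =>
      calc x ^ (n + 1) * y * (x ^ (n + 1))⁻¹ = x ^ n * (x * y * x⁻¹) * (x ^ n)⁻¹ := by
            rw [pow_succ]
            group
        _ = (x ^ n * y * (x ^ n)⁻¹) * (x ^ n * c * (x ^ n)⁻¹) := by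
            rw [h]
            group
        _ = y * c ^ (n + 1) := by
            rw [ih, (hc.pow_left n).eq, mul_inv_cancel_right, mul_assoc, pow_succ]
  have h1 := key (orderOf x)
  rw [pow_orderOf_eq_one] at h1
  have h2 : c ^ orderOf x = 1 := by simpa using h1
  have h3 : orderOf c ∣ orderOf x := orderOf_dvd_of_pow_eq_one h2
  exact orderOf_eq_one_iff.1 (Nat.Coprime.eq_one_of_dvd hcop h3)

theorem IsPGroup.coprime_orderOf {P : Subgroup K} (hP : IsPGroup p P) {x c : K} (hc : c ∈ P)
    (hx : (orderOf x).Coprime p) : (orderOf c).Coprime (orderOf x) := by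
  simpa using hP.orderOf_coprime hx.symm ⟨c, hc⟩

theorem IsPGroup.eq_one_of_coprime {P : Subgroup K} (hP : IsPGroup p P) {x : K} (hxP : x ∈ P)
    (hx : (orderOf x).Coprime p) : x = 1 :=
  orderOf_eq_one_iff.1 ((Nat.coprime_self _).1 (hP.coprime_orderOf hxP hx))

theorem conj_smul_eq_self_iff {g : K} {P : Subgroup K} :
    MulAut.conj g • P = P ↔ g ∈ normalizer (P : Set K) := by
  have key : ∀ g ∈ normalizer (P : Set K), MulAut.conj g • P ≤ P := by
    rintro g hg _ ⟨y, hy, rfl⟩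
    exact (mem_normalizer_iff.1 hg y).1 hy
  constructor
  · intro h
    refine mem_normalizer_iff.2 fun y => ?_
    conv_rhs => rw [← h]
    have : g * y * g⁻¹ = MulAut.conj g • y := rfl
    rw [this]
    exact (smul_mem_pointwise_smul_iff (a := MulAut.conj g)).symm
  · intro h
    refine le_antisymm (key g h) ?_
    have := key g⁻¹ (inv_mem h)
    rwa [map_inv, ← subset_pointwise_smul_iff] at this

theorem smul_normalizer (φ : MulAut K) (P : Subgroup K) :
    normalizer ((φ • P : Subgroup K) : Set K) = φ • normalizer (P : Set K) := by
  ext g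
  rw [mem_pointwise_smul_iff_inv_smul_mem, mem_normalizer_iff, mem_normalizer_iff]
  constructor
  · intro h y
    have := h (φ • y)
    rw [smul_mem_pointwise_smul_iff, mem_pointwise_smul_iff_inv_smul_mem] at this
    simpa using this
  · intro h y
    rw [mem_pointwise_smul_iff_inv_smul_mem, mem_pointwise_smul_iff_inv_smul_mem]
    simpa using h (φ⁻¹ • y)

theorem le_normalizer_inf {L P Q : Subgroup K} (hP : L ≤ normalizer (P : Set K))
    (hQ : L ≤ normalizer (Q : Set K)) : L ≤ normalizer ((P ⊓ Q : Subgroup K) : Set K) :=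
  fun _ hg => mem_normalizer_iff.2 fun y =>
    and_congr (mem_normalizer_iff.1 (hP hg) y) (mem_normalizer_iff.1 (hQ hg) y)

theorem centralizer_le_normalizer_zpowers {P : Subgroup K} {z : K} (hz : z ∈ P) :
    centralizer (P : Set K) ≤ normalizer (zpowers z : Set K) :=
  (centralizer_le (zpowers_le.2 hz)).trans (centralizer_le_normalizer _)

theorem mem_map_center_iff {P : Subgroup K} {x : K} :
    x ∈ (center P).map P.subtype ↔ x ∈ P ∧ x ∈ centralizer (P : Set K) := by
  constructor
  · rintro ⟨z, hz, rfl⟩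
    exact ⟨z.2, fun y hy => congrArg Subtype.val (mem_center_iff.1 hz ⟨y, hy⟩)⟩
  · rintro ⟨hx, hxc⟩
    exact ⟨⟨x, hx⟩, mem_center_iff.2 fun y => Subtype.ext (hxc y y.2), rfl⟩

/-- `O_p(L)` as a subgroup of the ambient group. -/
def opOf (p : ℕ) (L : Subgroup K) : Subgroup K := (pCore p L).map L.subtype

theorem opOf_le (L : Subgroup K) : opOf p L ≤ L := map_subtype_le _

theorem le_normalizer_opOf (L : Subgroup K) : L ≤ normalizer (opOf p L : Set K) := by
  have key : ∀ g ∈ L, ∀ y ∈ opOf p L, g * y * g⁻¹ ∈ opOf p L := by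
    rintro g hg _ ⟨y, hy, rfl⟩
    exact ⟨_, (pCore_normal p).conj_mem y hy ⟨g, hg⟩, rfl⟩
  refine fun g hg => mem_normalizer_iff.2 fun y => ⟨key g hg y, fun h => ?_⟩
  simpa [mul_assoc] using key g⁻¹ (inv_mem hg) _ h

theorem le_opOf {N L : Subgroup K} (hNL : N ≤ L) (hN : IsPGroup p N)
    (hn : L ≤ normalizer (N : Set K)) : N ≤ opOf p L := by
  have hle : N.subgroupOf L ≤ pCore p L :=
    le_sSup ⟨normal_subgroupOf_of_le_normalizer hn, hN.comap_subtype⟩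
  calc N = (N.subgroupOf L).map L.subtype := (map_subgroupOf_eq_of_le hNL).symm
    _ ≤ opOf p L := map_mono hle

theorem hasCharacteristic_iff {L : Subgroup K} :
    HasCharacteristic p L ↔ ∀ x ∈ L, x ∈ centralizer (opOf p L : Set K) → x ∈ opOf p L := by
  constructor
  · intro h x hx hxc
    refine ⟨⟨x, hx⟩, h ?_, rfl⟩
    intro y hy
    exact Subtype.ext (hxc y ⟨y, hy, rfl⟩)
  · intro h x hx
    obtain ⟨y, hy, hyx⟩ := h x x.2 (by
      rintro _ ⟨y, hy, rfl⟩
      exact congrArg Subtype.val (hx y hy))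
    rwa [← Subtype.ext hyx]

theorem isPGroup_pCore (p : ℕ) (K : Type*) [Group K] : IsPGroup p (pCore p K) :=
  Sylow.sSup_of_normal _ (fun _ h => h.2) fun _ h => h.1

theorem isPGroup_opOf (L : Subgroup K) : IsPGroup p (opOf p L) := (isPGroup_pCore p L).map _

theorem opOf_smul (φ : MulAut K) (L : Subgroup K) : opOf p (φ • L) = φ • opOf p L := by
  have key : ∀ (φ : MulAut K) (L : Subgroup K), φ • opOf p L ≤ opOf p (φ • L) := by
    intro φ L
    refine le_opOf (pointwise_smul_le_pointwise_smul_iff.2 (opOf_le L)) ((isPGroup_opOf L).map _) ?_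
    rw [smul_normalizer]
    exact pointwise_smul_le_pointwise_smul_iff.2 (le_normalizer_opOf L)
  refine le_antisymm ?_ (key φ L)
  have := key φ⁻¹ (φ • L)
  rwa [inv_smul_smul, ← subset_pointwise_smul_iff] at this

theorem normalizer_le_normalizer_opOf (L : Subgroup K) :
    normalizer (L : Set K) ≤ normalizer (opOf p L : Set K) := fun g hg => by
  rw [← conj_smul_eq_self_iff, ← opOf_smul, conj_smul_eq_self_iff.2 hg]

variable [Fact p.Prime]

theorem mem_distinguishedBrown_iff {P : Subgroup K} :
    P ∈ distinguishedBrown p K ↔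
      IsPGroup p P ∧ ∃ z ∈ P, z ∈ centralizer (P : Set K) ∧ IsPCentral p z := by
  constructor
  · rintro ⟨⟨hP, -⟩, hne⟩
    refine ⟨hP, ?_⟩
    by_contra! hcon
    refine hne (eq_bot_iff.2 ((closure_le _).2 fun z hz => ?_))
    have hle : omegaOneCenter p P ≤ (center P).map P.subtype := (closure_le _).2 fun y hy => hy.1
    have h := mem_map_center_iff.1 (hle hz.1)
    exact absurd hz.2 (hcon z h.1 h.2)
  · rintro ⟨hP, z, hzP, hzc, hz⟩
    have hz1 : z ≠ 1 := fun h => by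
      have := hz.1
      rw [h, orderOf_one] at this
      exact (Fact.out : p.Prime).ne_one this.symm
    refine ⟨⟨hP, fun h => hz1 (by simpa [h] using hzP)⟩, fun h => hz1 ?_⟩
    have hmem : z ∈ centralHat p P := subset_closure ⟨subset_closure
      ⟨mem_map_center_iff.2 ⟨hzP, hzc⟩, by rw [← hz.1, pow_orderOf_eq_one]⟩, hz⟩
    simpa [h] using hmem

/-- A Sylow subgroup whose center contains `z` normalizes `⟨z⟩`, so this `p`-local subgroup is
parabolic. -/
theorem HasParabolicCharacteristic.normalizer_zpowers (hK : HasParabolicCharacteristic p K) {z : K}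
    (hz : IsPCentral p z) : HasCharacteristic p (normalizer (zpowers z : Set K)) := by
  have hcard : Nat.card (zpowers z) = p := (Nat.card_zpowers z).trans hz.1
  obtain ⟨S, hS⟩ := hz.2
  refine hK _ ⟨zpowers z, IsPGroup.of_card (n := 1) (by rw [hcard, pow_one]), fun h => ?_, rfl⟩
    ⟨S, fun s hs => centralizer_le_normalizer _ ?_⟩
  · rw [h, card_bot] at hcard
    exact (Fact.out : p.Prime).ne_one hcard.symm
  · have hc : zpowers z ≤ centralizer {s} := by
      rw [zpowers_le, mem_centralizer_singleton_iff]
      exact ((mem_map_center_iff.1 hS).2 s hs).symm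
    exact fun y hy => mem_centralizer_singleton_iff.1 (hc hy)

/-! ### Transfer of characteristic `p` between subgroups of a finite group. -/

variable [Finite K]

/-- Without nontrivial `p'`-elements, `C_L(O_p(L))` is a normal `p`-subgroup of `L`, hence contained
in `O_p(L)`. -/
theorem hasCharacteristic_of_coprime {L : Subgroup K}
    (h : ∀ x ∈ L, (orderOf x).Coprime p → x ∈ centralizer (opOf p L : Set K) → x = 1) :
    HasCharacteristic p L := by
  rw [hasCharacteristic_iff]
  suffices hle : L ⊓ centralizer (opOf p L : Set K) ≤ opOf p L from fun x hx hxc => hle ⟨hx, hxc⟩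
  refine le_opOf inf_le_left ?_ (le_normalizer_inf le_normalizer
    ((le_normalizer_opOf L).trans (normalizer_le_normalizer_centralizer _)))
  rw [isPGroup_iff_pow_pow_eq_one]
  intro x
  obtain ⟨k, m, hm, hk⟩ := Nat.exists_eq_pow_mul_and_not_dvd (orderOf_pos (x : K)).ne' p
    (Fact.out : p.Prime).ne_one
  refine ⟨k, Subtype.ext ?_⟩
  refine h _ (x ^ p ^ k).2.1 ?_ (x ^ p ^ k).2.2
  have hord : orderOf ((x : K) ^ p ^ k) = m := by
    rw [orderOf_pow' _ (pow_pos (Fact.out : p.Prime).pos k).ne', hk, Nat.gcd_mul_right_left,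
      Nat.mul_div_cancel_left _ (pow_pos (Fact.out : p.Prime).pos k)]
  change (orderOf ((x : K) ^ p ^ k)).Coprime p
  rw [hord]
  exact ((Nat.Prime.coprime_iff_not_dvd Fact.out).2 hm).symm

theorem IsPGroup.exists_mem_normalizer_of_lt {D R : Subgroup K} (hR : IsPGroup p R) (h : D < R) :
    ∃ r ∈ R, r ∈ normalizer (D : Set K) ∧ r ∉ D := by
  have := hR.isNilpotent
  have hlt : D.subgroupOf R < ⊤ :=
    lt_top_iff_ne_top.2 fun htop => h.not_ge (subgroupOf_eq_top.1 htop)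
  obtain ⟨r, hr, hrD⟩ := SetLike.exists_of_lt (Group.normalizerCondition_of_isNilpotent _ hlt)
  refine ⟨r, r.2, mem_normalizer_iff.2 fun y => ?_, hrD⟩
  constructor
  · intro hy
    exact (mem_normalizer_iff.1 hr ⟨y, h.le hy⟩).1 hy
  · intro hy
    have hyR : y ∈ R := by
      have := R.mul_mem (R.mul_mem (R.inv_mem r.2) (h.le hy)) r.2
      simpa [mul_assoc] using this
    exact (mem_normalizer_iff.1 hr ⟨y, hyR⟩).2 hy

/-- Thompson's `A × B` lemma. -/
theorem commute_of_commute_centralizer {P Q : Subgroup K} (hP : IsPGroup p P) (hQ : IsPGroup p Q)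
    (hQP : Q ≤ normalizer (P : Set K)) {x : K} (hx : (orderOf x).Coprime p)
    (hxP : x ∈ normalizer (P : Set K)) (hxQ : x ∈ centralizer (Q : Set K))
    (hxPQ : ∀ y ∈ P, y ∈ centralizer (Q : Set K) → Commute x y) : ∀ y ∈ P, Commute x y := by
  by_contra! hcon
  obtain ⟨y, hyP, hy⟩ := hcon
  have hR : IsPGroup p (Q ⊔ P : Subgroup K) := hQ.to_sup_of_normal_right' hP hQP
  have hmemD : ∀ g, g ∈ (Q ⊔ P) ⊓ centralizer {x} ↔ g ∈ Q ⊔ P ∧ Commute x g := fun g => by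
    rw [mem_inf, mem_centralizer_singleton_iff]
    exact and_congr_right fun _ => ⟨fun h => h.symm, fun h => h.symm⟩
  have hlt : (Q ⊔ P) ⊓ centralizer {x} < Q ⊔ P :=
    lt_of_le_of_ne inf_le_left fun h =>
      hy ((hmemD y).1 (h.ge (le_sup_right (a := Q) hyP))).2
  have hQD : Q ≤ (Q ⊔ P) ⊓ centralizer {x} := fun q hq =>
    (hmemD q).2 ⟨le_sup_left (a := Q) hq, (hxQ q hq).symm⟩
  -- With `D = C_{QP}(x)` proper in the `p`-group `QP`, normalizers grow; as `Q ≤ D`, the new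
  -- element can be corrected by `Q` to some `g ∈ P` that normalizes `D` but does not commute with
  -- `x`.
  obtain ⟨r, hrR, hrN, hrD⟩ := hR.exists_mem_normalizer_of_lt hlt
  have hr' : r ∈ (Q : Set K) * (P : Set K) := by
    rw [← coe_mul_of_left_le_normalizer_right Q P hQP]
    exact hrR
  obtain ⟨q₀, hq₀, g, hg, rfl⟩ := hr'
  have hgN : g ∈ normalizer (((Q ⊔ P) ⊓ centralizer {x} : Subgroup K) : Set K) := by
    simpa using mul_mem (inv_mem (le_normalizer (hQD hq₀))) hrN
  have hgD : g ∉ (Q ⊔ P) ⊓ centralizer {x} := fun h => hrD (mul_mem (hQD hq₀) h)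
  have hcP : g⁻¹ * (x * g * x⁻¹) ∈ P :=
    mul_mem (inv_mem hg) ((mem_normalizer_iff.1 hxP g).1 hg)
  -- For `q ∈ Q` the element `[q, g]` lies in `D`, so it commutes with `x`. Comparing it with its
  -- conjugate by `x` shows that `g` and `x g x⁻¹` act alike on `Q`, so their quotient centralizes
  -- `Q`.
  have hc : Commute x (g⁻¹ * (x * g * x⁻¹)) := by
    refine hxPQ _ hcP fun q hq => ?_
    have h1 : q * (g * q⁻¹ * g⁻¹) ∈ (Q ⊔ P) ⊓ centralizer {x} :=
      mul_mem (hQD hq) ((mem_normalizer_iff.1 hgN _).1 (inv_mem (hQD hq)))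
    have h2 : x * (q * (g * q⁻¹ * g⁻¹)) * x⁻¹ = q * (g * q⁻¹ * g⁻¹) := by
      rw [((hmemD _).1 h1).2.eq, mul_inv_cancel_right]
    have hxq : x * q = q * x := (hxQ q hq).symm
    have hxq' : x * q⁻¹ = q⁻¹ * x := ((hxQ q⁻¹ (inv_mem hq)).symm : x * q⁻¹ = q⁻¹ * x)
    have h3 : x * (q * (g * q⁻¹ * g⁻¹)) * x⁻¹ =
        q * ((x * g * x⁻¹) * q⁻¹ * (x * g * x⁻¹)⁻¹) := by
      calc x * (q * (g * q⁻¹ * g⁻¹)) * x⁻¹ = (x * q) * g * (x⁻¹ * (x * q⁻¹)) * g⁻¹ * x⁻¹ := by group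
        _ = (q * x) * g * (x⁻¹ * (q⁻¹ * x)) * g⁻¹ * x⁻¹ := by rw [hxq, hxq']
        _ = _ := by group
    rw [h3] at h2
    have h4 : (x * g * x⁻¹) * q⁻¹ * (x * g * x⁻¹)⁻¹ = g * q⁻¹ * g⁻¹ := mul_left_cancel h2
    have h5 : (x * g * x⁻¹) * q * (x * g * x⁻¹)⁻¹ = g * q * g⁻¹ := by
      have := congrArg (·⁻¹) h4
      simpa [mul_assoc] using this
    calc q * (g⁻¹ * (x * g * x⁻¹)) = g⁻¹ * (g * q * g⁻¹) * (x * g * x⁻¹) := by group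
      _ = g⁻¹ * ((x * g * x⁻¹) * q * (x * g * x⁻¹)⁻¹) * (x * g * x⁻¹) := by rw [h5]
      _ = g⁻¹ * (x * g * x⁻¹) * q := by group
  have h1 := eq_one_of_conj_eq_mul (x := x) (y := g) (c := g⁻¹ * (x * g * x⁻¹)) (by group) hc
    (hP.coprime_orderOf hcP hx)
  refine hgD ((hmemD g).2 ⟨le_sup_right (a := Q) hg, ?_⟩)
  have h2 : x * g * x⁻¹ = g := by
    rw [inv_mul_eq_one] at h1
    exact h1.symm
  exact mul_inv_eq_iff_eq_mul.1 h2

/-- A `p'`-element centralizing `O_p(N_L(Q))` centralizes both `Q` and `C_{O_p(L)}(Q)`, as both lie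
in that core. The `A × B` lemma then makes it centralize `O_p(L)`, and characteristic `p` of `L`
forces it to be trivial. -/
theorem HasCharacteristic.inf_normalizer {L Q : Subgroup K} (hL : HasCharacteristic p L)
    (hQ : IsPGroup p Q) (hQL : Q ≤ L) :
    HasCharacteristic p (L ⊓ normalizer (Q : Set K) : Subgroup K) := by
  refine hasCharacteristic_of_coprime fun x hx hxp hxc => ?_
  have h1 : Q ≤ opOf p (L ⊓ normalizer (Q : Set K)) :=
    le_opOf (le_inf hQL le_normalizer) hQ inf_le_right
  have h2 : opOf p L ⊓ (L ⊓ normalizer (Q : Set K)) ≤ opOf p (L ⊓ normalizer (Q : Set K)) :=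
    le_opOf inf_le_right (isPGroup_opOf L).to_inf_left
      (le_normalizer_inf (inf_le_left.trans (le_normalizer_opOf L)) le_normalizer)
  have h3 := commute_of_commute_centralizer (isPGroup_opOf L) hQ
    (hQL.trans (le_normalizer_opOf L)) hxp (le_normalizer_opOf L hx.1) (fun q hq => hxc q (h1 hq))
    fun y hy hyQ => (hxc y (h2 ⟨hy, opOf_le L hy, centralizer_le_normalizer (Q : Set K) hyQ⟩)).symm
  exact (isPGroup_opOf L).eq_one_of_coprime
    (hasCharacteristic_iff.1 hL x hx.1 fun y hy => (h3 y hy).symm) hxp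

/-- Characteristic `p` passes from `L` to `M` through a common normal subgroup `E`. For a
`p'`-element `x` of `C_M(O_p(M)) ≤ E`, the commutators of `x` with `O_p(L)` lie in `O_p(L) ∩ E ≤
O_p(M)`, which `x` centralizes. Coprime action then makes `x` centralize `O_p(L)`. -/
theorem HasCharacteristic.of_normal {M L E : Subgroup K} (hL : HasCharacteristic p L)
    (hEL : E ≤ L) (hLE : L ≤ normalizer (E : Set K)) (hEM : E ≤ M)
    (hME : M ≤ normalizer (E : Set K)) (hE : M ⊓ centralizer (opOf p M : Set K) ≤ E) :
    HasCharacteristic p M := by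
  refine hasCharacteristic_of_coprime fun x hx hxp hxc => ?_
  have hxE := hE ⟨hx, hxc⟩
  have h1 : opOf p L ⊓ E ≤ opOf p M :=
    (le_opOf inf_le_right (isPGroup_opOf L).to_inf_left
      (le_normalizer_inf (hEL.trans (le_normalizer_opOf L)) le_normalizer)).trans
    (le_opOf ((opOf_le E).trans hEM) (isPGroup_opOf E)
      (hME.trans (normalizer_le_normalizer_opOf E)))
  refine (isPGroup_opOf L).eq_one_of_coprime (hasCharacteristic_iff.1 hL x (hEL hxE)
    fun y hy => ?_) hxp
  have hcL : y⁻¹ * (x * y * x⁻¹) ∈ opOf p L :=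
    mul_mem (inv_mem hy) ((mem_normalizer_iff.1 (le_normalizer_opOf L (hEL hxE)) y).1 hy)
  have hcE : y⁻¹ * (x * y * x⁻¹) ∈ E := by
    have h := (mem_normalizer_iff.1 (hLE (inv_mem (opOf_le L hy))) x).1 hxE
    simpa [mul_assoc] using mul_mem h (inv_mem hxE)
  have h2 := eq_one_of_conj_eq_mul (x := x) (y := y) (c := y⁻¹ * (x * y * x⁻¹)) (by group)
    (hxc _ (h1 ⟨hcL, hcE⟩)).symm ((isPGroup_opOf L).coprime_orderOf hcL hxp)
  rw [inv_mul_eq_one] at h2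
  exact mul_inv_eq_iff_eq_mul.1 h2.symm |>.symm

theorem exists_isPCentral (S : Sylow p K) (hS : (S : Subgroup K) ≠ ⊥) :
    ∃ z ∈ S, z ∈ centralizer ((S : Subgroup K) : Set K) ∧ IsPCentral p z := by
  have hnt : Nontrivial S := (nontrivial_iff_ne_bot _).2 hS
  have hc : Nontrivial (center S) := S.2.center_nontrivial
  obtain ⟨n, hn, hcard⟩ := ((S.2.to_subgroup (center S)).nontrivial_iff_card).1 hc
  obtain ⟨z, hz⟩ := exists_prime_orderOf_dvd_card' (G := center S) p
    (hcard ▸ dvd_pow_self p hn.ne')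
  have hmem : ((z : S) : K) ∈ (center S).map (S : Subgroup K).subtype := ⟨z, z.2, rfl⟩
  have h := mem_map_center_iff.1 hmem
  exact ⟨_, h.1, h.2,
    (Subgroup.orderOf_coe (z : S)).trans ((Subgroup.orderOf_coe z).trans hz), S, hmem⟩

/-- For a `p`-central `z ∈ Z(Q)`, both `N(⟨z⟩)` and `N(⟨z⟩) ∩ N(Q)` have characteristic `p`. The
latter shares the normal subgroup `C(Q)` with `M`, and `C(Q)` contains `C_M(O_p(M))` because `Q ≤
O_p(M)`. Allowing any `M` between `C(Q) Q` and `N(Q)` covers `N_C(Q)` as well as the full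
normalizer. -/
theorem HasParabolicCharacteristic.of_mem_distinguishedBrown (hK : HasParabolicCharacteristic p K)
    {Q M : Subgroup K} (hQ : Q ∈ distinguishedBrown p K) (hQM : Q ≤ M)
    (hM : M ≤ normalizer (Q : Set K)) (hcM : centralizer (Q : Set K) ≤ M) :
    HasCharacteristic p M := by
  obtain ⟨hQp, z, hzQ, hzc, hz⟩ := mem_distinguishedBrown_iff.1 hQ
  have hQL : Q ≤ normalizer (zpowers z : Set K) := by
    refine le_trans (fun q hq => ?_) (centralizer_le_normalizer _)
    have hc : zpowers z ≤ centralizer {q} := by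
      rw [zpowers_le, mem_centralizer_singleton_iff]
      exact (hzc q hq).symm
    exact fun y hy => mem_centralizer_singleton_iff.1 (hc hy)
  have h := (hK.normalizer_zpowers hz).inf_normalizer hQp hQL
  have hn := normalizer_le_normalizer_centralizer Q
  exact h.of_normal (E := centralizer (Q : Set K))
    (le_inf (centralizer_le_normalizer_zpowers hzQ) (centralizer_le_normalizer _))
    (inf_le_right.trans hn) hcM (hM.trans hn)
    fun x hx q hq => hx.2 q (le_opOf hQM hQp hM hq)

/-- The element is taken from the center of a Sylow subgroup above `D`. It centralizes `Q`, hence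
lies in `N`; it centralizes `O_p(N)`, hence lies in `O_p(N)`. -/
theorem exists_isPCentral_mem_opOf {N Q D : Subgroup K} (hN : HasCharacteristic p N)
    (hQN : Q ≤ opOf p N) (hQ : centralizer (Q : Set K) ≤ N) (hD : IsPGroup p D)
    (hND : opOf p N ≤ D) (hne : D ≠ ⊥) :
    ∃ z ∈ opOf p N, z ∈ centralizer (D : Set K) ∧ IsPCentral p z := by
  obtain ⟨S, hS⟩ := hD.exists_le_sylow
  obtain ⟨z, -, hzc, hz⟩ := exists_isPCentral S fun h => hne (le_bot_iff.1 (h ▸ hS))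
  have hzD : z ∈ centralizer (D : Set K) := centralizer_le hS hzc
  exact ⟨z, hasCharacteristic_iff.1 hN z (hQ (centralizer_le (hQN.trans hND) hzD))
    (centralizer_le hND hzD), hzD, hz⟩

end CharacteristicP

/-! ### Removing subgroups that differ from the `p`-cores of their normalizers -/

instance SubMulAction.covariantClass_le {H α : Type*} [Group H] [PartialOrder α] [MulAction H α]
    [CovariantClass H α (· • ·) (· ≤ ·)] (s : SubMulAction H α) :
    CovariantClass H s (· • ·) (· ≤ ·) where
  elim h _ _ hab := CovariantClass.elim (M := H) (N := α) (μ := (· • ·)) (r := (· ≤ ·)) h hab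

section NormalizerCore

variable {H K α β : Type*} [Group H] [Group K] [Finite K] {ρ : H →* MulAut K}
  [PartialOrder α] [Finite α] [MulAction H α] [CovariantClass H α (· • ·) (· ≤ ·)]
  [PartialOrder β] [Finite β] [MulAction H β] [CovariantClass H β (· • ·) (· ≤ ·)]
  {p : ℕ} [Fact p.Prime]

/-- The contraction of `{R ∈ α | P < R}` is
`R ≥ N_R(P) ≤ N_R(P) T O_p(N_C(P)) ≥ T O_p(N_C(P))`. -/
theorem equivariantlyHomotopyEquivalent_of_lt_sup_opOf {T C : Subgroup K} (hT : IsPGroup p T)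
    (hTC : T ≤ C) (hTρ : ∀ h : H, ρ h • T = T) (hCρ : ∀ h : H, ρ h • C = C)
    {j : α → Subgroup K} (hj : ∀ x y, j x ≤ j y ↔ x ≤ y) (hjH : ∀ (h : H) x, j (h • x) = ρ h • j x)
    {i : β → α} (hi : ∀ x y, i x ≤ i y ↔ x ≤ y) (hiH : ∀ (h : H) x, i (h • x) = h • i x)
    (hp : ∀ x, IsPGroup p (j x)) (hjC : ∀ x, j x ≤ C) (hjT : ∀ x, T ≤ normalizer (j x : Set K))
    (hlt : ∀ w ∉ Set.range i, j w < T ⊔ opOf p (normalizer (j w : Set K) ⊓ C : Subgroup K))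
    (hinf : ∀ w ∉ Set.range i, ∀ x, w < x →
      j x ⊓ (normalizer (j w : Set K) ⊓ C) ∈ Set.range j)
    (hmem : ∀ w ∉ Set.range i, ∀ D : Subgroup K, IsPGroup p D →
      D ≤ normalizer (j w : Set K) ⊓ C →
      T ⊔ opOf p (normalizer (j w : Set K) ⊓ C : Subgroup K) ≤ D → D ∈ Set.range j) :
    EquivariantlyHomotopyEquivalent H (OrderComplex α) (OrderComplex β) := by
  have hNH : ∀ (h : H) (P : Subgroup K), normalizer ((ρ h • P : Subgroup K) : Set K) ⊓ C =
      ρ h • (normalizer (P : Set K) ⊓ C) := fun h P => by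
    rw [smul_normalizer, smul_inf, hCρ]
  have hTN : ∀ x, T ≤ normalizer (j x : Set K) ⊓ C := fun x => le_inf (hjT x) hTC
  have hfH : ∀ (h : H) (P Q : Subgroup K),
      (ρ h • Q) ⊓ (normalizer ((ρ h • P : Subgroup K) : Set K) ⊓ C) =
        ρ h • (Q ⊓ (normalizer (P : Set K) ⊓ C)) := fun h P Q => by
    rw [hNH, smul_inf (ρ h) Q]
  have heH : ∀ (h : H) (P : Subgroup K),
      T ⊔ opOf p (normalizer ((ρ h • P : Subgroup K) : Set K) ⊓ C : Subgroup K) =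
        ρ h • (T ⊔ opOf p (normalizer (P : Set K) ⊓ C : Subgroup K)) := fun h P => by
    rw [hNH, opOf_smul, smul_sup, hTρ]
  have hep : ∀ w, IsPGroup p (T ⊔ opOf p (normalizer (j w : Set K) ⊓ C : Subgroup K) : Subgroup K) :=
    fun w => hT.to_sup_of_normal_right' (isPGroup_opOf _)
      ((hTN w).trans (le_normalizer_opOf _))
  refine equivariantlyHomotopyEquivalent_of_contractsAbove (ρ := ρ) hj hjH hi hiH
    (f := fun P R => R ⊓ (normalizer (P : Set K) ⊓ C))
    (g := fun P R => R ⊓ (normalizer (P : Set K) ⊓ C) ⊔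
      (T ⊔ opOf p (normalizer (P : Set K) ⊓ C : Subgroup K)))
    (e := fun P => T ⊔ opOf p (normalizer (P : Set K) ⊓ C : Subgroup K))
    (fun P Q R h => inf_le_inf_right _ h)
    (fun P Q R h => sup_le_sup_right (inf_le_inf_right _ h) _)
    (fun P Q => inf_le_left) (fun P Q => le_sup_left) (fun P Q => le_sup_right) hfH ?_ heH ?_ ?_ ?_
  · intro h P Q
    simp only [hfH, heH, smul_sup]
  · intro w hw x hwx
    refine ⟨?_, hinf w hw x hwx⟩
    have hjlt : j w < j x := lt_of_le_of_ne ((hj _ _).2 hwx.le) fun h =>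
      hwx.not_ge ((hj _ _).1 h.ge)
    -- Normalizers grow in the `p`-group `R`, so `N_R(P)` stays strictly above `P`.
    obtain ⟨r, hrx, hrN, hrw⟩ := (hp x).exists_mem_normalizer_of_lt hjlt
    refine lt_of_le_of_ne (le_inf hjlt.le (le_inf le_normalizer (hjC w))) fun h => hrw ?_
    rw [h]
    exact ⟨hrx, hrN, hjC x hrx⟩
  · intro w hw x hwx
    refine hmem w hw _ ?_ (sup_le inf_le_right (sup_le (hTN w) (opOf_le _))) le_sup_right
    -- The triple product is a `p`-group in two stages: `T` normalizes `N_R(P)`, and both normalize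
    -- `O_p(N_C(P))`.
    have h1 : IsPGroup p (T ⊔ j x ⊓ (normalizer (j w : Set K) ⊓ C) : Subgroup K) :=
      hT.to_sup_of_normal_right' (hp x).to_inf_left
        (le_normalizer_inf (hjT x) ((hTN w).trans le_normalizer))
    have h2 := h1.to_sup_of_normal_right'
      (isPGroup_opOf (p := p) (normalizer (j w : Set K) ⊓ C : Subgroup K))
      ((sup_le (hTN w) inf_le_right).trans (le_normalizer_opOf _))
    rwa [sup_comm T, sup_assoc] at h2
  · exact fun w hw => ⟨hlt w hw, hmem w hw _ (hep w) (sup_le (hTN w) (opOf_le _)) le_rfl⟩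

end NormalizerCore

/-! ### The quotient of the centralizer -/

theorem isPCentral_of_mem_sylow {K : Type*} [Group K] {p : ℕ} {S : Sylow p K} {z : K} (hz : z ∈ S)
    (hzc : z ∈ centralizer ((S : Subgroup K) : Set K)) (ho : orderOf z = p) : IsPCentral p z :=
  ⟨ho, S, mem_map_center_iff.2 ⟨hz, hzc⟩⟩

section CentralizerQuotient

variable {G : Type*} [Group G] {p : ℕ} {T : Subgroup G}

/-- The preimage in `C_G(T)` of a subgroup of `C_G(T) / O_p(C_G(T))`, as a subgroup of `G`. -/
def quotientPreimage (Q : Subgroup (CentralizerQuotient p T)) : Subgroup G :=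
  (Q.comap (QuotientGroup.mk' _)).map (centralizer (T : Set G)).subtype

theorem mem_quotientPreimage {Q : Subgroup (CentralizerQuotient p T)} {x : G} :
    x ∈ quotientPreimage Q ↔
      ∃ y : centralizer (T : Set G), (y : CentralizerQuotient p T) ∈ Q ∧ (y : G) = x :=
  Iff.rfl

theorem coe_mem_quotientPreimage {Q : Subgroup (CentralizerQuotient p T)}
    {y : centralizer (T : Set G)} :
    (y : G) ∈ quotientPreimage Q ↔ (y : CentralizerQuotient p T) ∈ Q := by
  rw [mem_quotientPreimage]
  exact ⟨fun ⟨z, hz, hzy⟩ => Subtype.ext hzy ▸ hz, fun h => ⟨y, h, rfl⟩⟩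

theorem quotientPreimage_le (Q : Subgroup (CentralizerQuotient p T)) :
    quotientPreimage Q ≤ centralizer (T : Set G) := map_subtype_le _

theorem quotientPreimage_le_iff {Q R : Subgroup (CentralizerQuotient p T)} :
    quotientPreimage Q ≤ quotientPreimage R ↔ Q ≤ R := by
  constructor
  · intro h x hx
    induction x using QuotientGroup.induction_on with
    | H z => exact coe_mem_quotientPreimage.1 (h (coe_mem_quotientPreimage.2 hx))
  · rintro h _ ⟨y, hy, rfl⟩
    exact ⟨y, h hy, rfl⟩

theorem opOf_le_quotientPreimage (Q : Subgroup (CentralizerQuotient p T)) :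
    opOf p (centralizer (T : Set G)) ≤ quotientPreimage Q := by
  rintro _ ⟨y, hy, rfl⟩
  refine ⟨y, ?_, rfl⟩
  change (y : CentralizerQuotient p T) ∈ Q
  rw [(QuotientGroup.eq_one_iff y).2 hy]
  exact one_mem Q

theorem isPGroup_quotientPreimage {Q : Subgroup (CentralizerQuotient p T)} (hQ : IsPGroup p Q) :
    IsPGroup p (quotientPreimage Q) := by
  refine (hQ.comap_of_ker_isPGroup _ ?_).map _
  rw [QuotientGroup.ker_mk']
  exact isPGroup_pCore _ _

theorem exists_quotientPreimage_eq {P : Subgroup G} (hP : IsPGroup p P)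
    (hPC : P ≤ centralizer (T : Set G)) (hO : opOf p (centralizer (T : Set G)) ≤ P) :
    ∃ Q : Subgroup (CentralizerQuotient p T), IsPGroup p Q ∧ quotientPreimage Q = P := by
  refine ⟨(P.subgroupOf _).map (QuotientGroup.mk' _), hP.comap_subtype.map _, ?_⟩
  rw [quotientPreimage, comap_map_eq, QuotientGroup.ker_mk', Subgroup.map_sup, map_subgroupOf_eq_of_le hPC]
  exact sup_eq_left.2 hO

theorem quotientPreimage_smul (h : normalizer (T : Set G))
    (Q : Subgroup (CentralizerQuotient p T)) :
    quotientPreimage (conjCentralizerQuotient p T h • Q) =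
      MulAut.conj (h : G) • quotientPreimage Q := by
  have hle : ∀ (h : normalizer (T : Set G)) (Q : Subgroup (CentralizerQuotient p T)),
      MulAut.conj (h : G) • quotientPreimage Q ≤
        quotientPreimage (conjCentralizerQuotient p T h • Q) := by
    rintro h Q _ ⟨_, ⟨y, hy, rfl⟩, rfl⟩
    exact ⟨conjCentralizer T h y, ⟨(y : CentralizerQuotient p T), hy, rfl⟩, rfl⟩
  refine le_antisymm ?_ (hle h Q)
  have := hle h⁻¹ (conjCentralizerQuotient p T h • Q)
  rwa [map_inv, inv_smul_smul, coe_inv, map_inv, ← subset_pointwise_smul_iff] at this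

theorem IsNoncentralOfOrder.isPGroup (hT : IsNoncentralOfOrder p T) : IsPGroup p T :=
  IsPGroup.of_card (n := 1) (by rw [hT.1, pow_one])

variable [Fact p.Prime]

theorem IsNoncentralOfOrder.le_centralizer (hT : IsNoncentralOfOrder p T) :
    T ≤ centralizer (T : Set G) := by
  have := isCyclic_of_prime_card hT.1
  intro x hx y hy
  obtain ⟨g, hg⟩ := IsCyclic.exists_generator (α := T)
  obtain ⟨m, hm⟩ := mem_zpowers_iff.1 (hg ⟨x, hx⟩)
  obtain ⟨n, hn⟩ := mem_zpowers_iff.1 (hg ⟨y, hy⟩)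
  have h : (⟨y, hy⟩ : T) * ⟨x, hx⟩ = ⟨x, hx⟩ * ⟨y, hy⟩ := by
    rw [← hm, ← hn]
    exact (Commute.refl g).zpow_zpow n m
  exact congrArg Subtype.val h

theorem IsNoncentralOfOrder.ne_bot (hT : IsNoncentralOfOrder p T) : T ≠ ⊥ := fun h => by
  have := hT.1
  rw [h, card_bot] at this
  exact (Fact.out : p.Prime).ne_one this.symm

theorem IsNoncentralOfOrder.le_opOf_centralizer (hT : IsNoncentralOfOrder p T) :
    T ≤ opOf p (centralizer (T : Set G)) :=
  le_opOf hT.le_centralizer hT.isPGroup (centralizer_le_normalizer (T : Set G))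

variable [Finite G]

/-- If `C_G(T)` does not have characteristic `p`, then `O_p(C_G(T))` contains no `p`-central
element of `G`. -/
theorem HasParabolicCharacteristic.hasCharacteristic_centralizer
    (hG : HasParabolicCharacteristic p G) (hT : IsNoncentralOfOrder p T) {z : G}
    (hz : IsPCentral p z) (hzO : z ∈ opOf p (centralizer (T : Set G))) :
    HasCharacteristic p (centralizer (T : Set G)) := by
  have hTL : T ≤ normalizer (zpowers z : Set G) := by
    refine le_trans (fun t ht => ?_) (centralizer_le_normalizer _)
    have hc : zpowers z ≤ centralizer {t} := by
      rw [zpowers_le, mem_centralizer_singleton_iff]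
      exact (opOf_le _ hzO t ht).symm
    exact fun y hy => mem_centralizer_singleton_iff.1 (hc hy)
  have hM := (hG.normalizer_zpowers hz).inf_normalizer hT.isPGroup hTL
  have hN := normalizer_le_normalizer_centralizer T
  -- The bridge is `E = C_C(O_p(C))`: it centralizes `z ∈ O_p(C)`, so it lies in `N(⟨z⟩) ∩ N(T)`,
  -- and `N(T)` normalizes it.
  refine hM.of_normal (E := centralizer (T : Set G) ⊓
      centralizer (opOf p (centralizer (T : Set G)) : Set G))
    (le_inf (inf_le_right.trans (centralizer_le_normalizer_zpowers hzO))
      (inf_le_left.trans (centralizer_le_normalizer (T : Set G))))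
    (inf_le_right.trans (le_normalizer_inf hN ((hN.trans
      (normalizer_le_normalizer_opOf _)).trans (normalizer_le_normalizer_centralizer _))))
    inf_le_left
    (le_normalizer_inf le_normalizer ((le_normalizer_opOf _).trans
      (normalizer_le_normalizer_centralizer _))) le_rfl

/-- A `p`-subgroup of `C_G(T) / O_p(C_G(T))` is centralized by an element of order `p` that lifts
to a `p`-central element of `G` centralizing the preimage. -/
theorem exists_isPCentral_centralizing_preimage (hG : HasParabolicCharacteristic p G)
    (hT : IsNoncentralOfOrder p T) (hC : ¬ HasCharacteristic p (centralizer (T : Set G)))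
    {Q : Subgroup (CentralizerQuotient p T)} (hQ : IsPGroup p Q) :
    ∃ z : centralizer (T : Set G), IsPCentral p (z : G) ∧
      (z : G) ∈ centralizer (quotientPreimage Q : Set G) ∧
      (z : CentralizerQuotient p T) ∈ centralizer (Q : Set (CentralizerQuotient p T)) ∧
      orderOf (z : CentralizerQuotient p T) = p := by
  have hTQ := hT.le_opOf_centralizer.trans (opOf_le_quotientPreimage Q)
  obtain ⟨S, hS⟩ := (isPGroup_quotientPreimage hQ).exists_le_sylow
  obtain ⟨z, -, hzc, hz⟩ := exists_isPCentral S fun h => hT.ne_bot (le_bot_iff.1 (h ▸ hTQ.trans hS))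
  have hzQ : z ∈ centralizer (quotientPreimage Q : Set G) := centralizer_le hS hzc
  have hzC : z ∈ centralizer (T : Set G) := centralizer_le hTQ hzQ
  refine ⟨⟨z, hzC⟩, hz, hzQ, fun x hx => ?_, orderOf_eq_prime ?_ fun h => hC ?_⟩
  · induction x using QuotientGroup.induction_on with
    | H y =>
      have h : y * ⟨z, hzC⟩ = ⟨z, hzC⟩ * y :=
        Subtype.ext (hzQ _ (coe_mem_quotientPreimage.2 hx))
      exact congrArg (fun u : centralizer (T : Set G) => (u : CentralizerQuotient p T)) h
  · have h : (⟨z, hzC⟩ : centralizer (T : Set G)) ^ p = 1 :=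
      Subtype.ext (by simpa [hz.1] using pow_orderOf_eq_one z)
    exact congrArg (fun u : centralizer (T : Set G) => (u : CentralizerQuotient p T)) h
  -- A trivial image would put `z` into `O_p(C_G(T))`.
  · exact hG.hasCharacteristic_centralizer hT hz
      ⟨⟨z, hzC⟩, (QuotientGroup.eq_one_iff _).1 h, rfl⟩

end CentralizerQuotient

/-! ### The fixed points and the quotient of the centralizer -/

section FixedPoints

variable {G : Type*} [Group G] {p : ℕ} {T : Subgroup G}

theorem conj_smul_self_of_normalizer (h : normalizer (T : Set G)) :
    MulAut.conj (h : G) • T = T := conj_smul_eq_self_iff.2 h.2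

theorem conj_smul_centralizer_of_normalizer (h : normalizer (T : Set G)) :
    MulAut.conj (h : G) • centralizer (T : Set G) = centralizer (T : Set G) :=
  conj_smul_eq_self_iff.2 (normalizer_le_normalizer_centralizer T h.2)

theorem le_conj_smul_iff {P : Subgroup G} (h : normalizer (T : Set G)) :
    T ≤ MulAut.conj (h : G) • P ↔ T ≤ P := by
  have := pointwise_smul_le_pointwise_smul_iff (a := MulAut.conj (h : G)) (S := T) (T := P)
  rwa [conj_smul_self_of_normalizer] at this

theorem conj_smul_le_centralizer_iff {P : Subgroup G} (h : normalizer (T : Set G)) :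
    MulAut.conj (h : G) • P ≤ centralizer (T : Set G) ↔ P ≤ centralizer (T : Set G) := by
  have := pointwise_smul_le_pointwise_smul_iff (a := MulAut.conj (h : G)) (S := P)
    (T := centralizer (T : Set G))
  rwa [conj_smul_centralizer_of_normalizer] at this

variable (p T)

/-- The distinguished subgroups that contain `T`. -/
def distinguishedAbove :
    SubMulAction (normalizer (T : Set G)) (fixedCollection (distinguishedBrown p G) T) where
  carrier := {Q | T ≤ (Q : Subgroup G)}
  smul_mem' h _ hQ := (le_conj_smul_iff h).2 hQ

/-- The distinguished subgroups of `C_G(T)` that contain `T`. -/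
def distinguishedBetween :
    SubMulAction (normalizer (T : Set G)) (fixedCollection (distinguishedBrown p G) T) where
  carrier := {Q | T ≤ (Q : Subgroup G) ∧ (Q : Subgroup G) ≤ centralizer (T : Set G)}
  smul_mem' h _ hQ := ⟨(le_conj_smul_iff h).2 hQ.1, (conj_smul_le_centralizer_iff h).2 hQ.2⟩

/-- The distinguished subgroups of `C_G(T) / O_p(C_G(T))` with distinguished preimage. -/
def distinguishedQuotient :
    SubMulAction (normalizer (T : Set G)) (distinguishedBrown p (CentralizerQuotient p T)) where
  carrier := {Q | quotientPreimage (Q : Subgroup (CentralizerQuotient p T)) ∈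
    distinguishedBrown p G}
  smul_mem' h Q hQ := by
    have := smul_mem_distinguishedBrown hQ (MulAut.conj (h : G))
    rwa [← quotientPreimage_smul] at this

variable {p T} [Fact p.Prime]

/-- A `p`-central element of `Z(R)` centralizes `P ≤ R`, so it survives in `R ∩ M`. -/
theorem inf_mem_distinguishedBrown {K : Type*} [Group K] {P R M : Subgroup K}
    (hR : R ∈ distinguishedBrown p K) (hPR : P ≤ R) (hM : centralizer (P : Set K) ≤ M) :
    R ⊓ M ∈ distinguishedBrown p K := by
  obtain ⟨hRp, z, hzR, hzc, hz⟩ := mem_distinguishedBrown_iff.1 hR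
  exact mem_distinguishedBrown_iff.2 ⟨hRp.to_inf_left, z, ⟨hzR, hM (centralizer_le hPR hzc)⟩,
    centralizer_le inf_le_left hzc, hz⟩

theorem mem_distinguishedBrown_of_opOf_le {K : Type*} [Group K] [Finite K] {P M D : Subgroup K}
    (hK : HasParabolicCharacteristic p K) (hP : P ∈ distinguishedBrown p K) (hPM : P ≤ M)
    (hM : M ≤ normalizer (P : Set K)) (hcM : centralizer (P : Set K) ≤ M) (hD : IsPGroup p D)
    (hMD : opOf p M ≤ D) : D ∈ distinguishedBrown p K := by
  have hPO : P ≤ opOf p M := le_opOf hPM hP.1.1 hM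
  obtain ⟨z, hzO, hzD, hz⟩ := exists_isPCentral_mem_opOf
    (hK.of_mem_distinguishedBrown hP hPM hM hcM) hPO hcM hD hMD
    fun h => hP.1.2 (le_bot_iff.1 (h ▸ hPO.trans hMD))
  exact mem_distinguishedBrown_iff.2 ⟨hD, z, hMD hzO, hzD, hz⟩

variable [Finite G]

/-- If `T` is not contained in `Q`, then `T O_p(N_G(Q))` is automatically strictly larger than `Q`.
-/
theorem equivariantlyHomotopyEquivalent_distinguishedAbove (hG : HasParabolicCharacteristic p G)
    (hT : IsNoncentralOfOrder p T) :
    EquivariantlyHomotopyEquivalent (normalizer (T : Set G))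
      (OrderComplex (fixedCollection (distinguishedBrown p G) T))
      (OrderComplex (distinguishedAbove p T)) := by
  refine equivariantlyHomotopyEquivalent_of_lt_sup_opOf (p := p)
    (ρ := MulAut.conj.comp (normalizer (T : Set G)).subtype) (T := T) (C := ⊤)
    hT.isPGroup le_top conj_smul_self_of_normalizer (fun h => ?_) (j := Subtype.val)
    (fun _ _ => Iff.rfl) (fun _ _ => rfl) (i := Subtype.val) (fun _ _ => Iff.rfl)
    (fun _ _ => rfl) (fun Q => Q.2.1.1.1) (fun _ => le_top) (fun Q => Q.2.2) ?_ ?_ ?_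
  · exact eq_top_iff.2 fun x _ => mem_pointwise_smul_iff_inv_smul_mem.2 trivial
  · intro Q hQ
    have hQO : Q.1 ≤ opOf p (normalizer (Q.1 : Set G) ⊓ ⊤ : Subgroup G) :=
      le_opOf (le_inf le_normalizer le_top) Q.2.1.1.1 inf_le_left
    refine lt_of_le_of_ne (hQO.trans le_sup_right) fun h => hQ ⟨⟨Q, ?_⟩, rfl⟩
    exact le_sup_left.trans h.ge
  · intro Q _ R hQR
    refine ⟨⟨_, inf_mem_distinguishedBrown R.2.1 hQR.le
      (le_inf (centralizer_le_normalizer _) le_top), ?_⟩, rfl⟩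
    exact le_normalizer_inf R.2.2 ((le_inf Q.2.2 le_top).trans le_normalizer)
  · intro Q _ D hD _ hle
    exact ⟨⟨D, mem_distinguishedBrown_of_opOf_le hG Q.2.1 (le_inf le_normalizer le_top) inf_le_left
      (le_inf (centralizer_le_normalizer _) le_top) hD (le_sup_right.trans hle),
      (le_sup_left.trans hle).trans le_normalizer⟩, rfl⟩

/-- Once `T ≤ Q`, the center of `Q` lies in `C_G(T)`, so `Q ↦ Q ∩ C_G(T)` stays among distinguished
subgroups. -/
theorem equivariantlyHomotopyEquivalent_distinguishedBetween (hT : IsNoncentralOfOrder p T) :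
    EquivariantlyHomotopyEquivalent (normalizer (T : Set G))
      (OrderComplex (distinguishedAbove p T)) (OrderComplex (distinguishedBetween p T)) := by
  cases nonempty_fintype (distinguishedAbove p T)
  cases nonempty_fintype (distinguishedBetween p T)
  let r : distinguishedAbove p T → distinguishedAbove p T := fun Q =>
    ⟨⟨Q.1.1 ⊓ centralizer (T : Set G),
      inf_mem_distinguishedBrown Q.1.2.1 Q.2 le_rfl,
      (le_inf Q.2 hT.le_centralizer).trans le_normalizer⟩, le_inf Q.2 hT.le_centralizer⟩
  refine OrderComplex.equivariantlyHomotopyEquivalent_of_deformsInto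
    (f := fun Q => ⟨Q.1, Q.2.1⟩) (fun _ _ => Iff.rfl) (fun _ _ => rfl)
    (OrderComplex.deformsInto_of_le_id (r := r) (fun P Q h => ?_) (fun Q => ?_) (fun Q => ?_) ?_
      fun h Q => ?_)
  · exact inf_le_inf_right (centralizer (T : Set G)) h
  · exact inf_le_left (a := Q.1.1)
  · exact ⟨⟨(r Q).1, (r Q).2, inf_le_right (a := Q.1.1)⟩, rfl⟩
  · rintro _ ⟨Q, rfl⟩
    exact Subtype.ext (Subtype.ext (inf_eq_left.2 Q.2.2))
  · refine Subtype.ext (Subtype.ext ?_)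
    change (MulAut.conj (h : G) • Q.1.1) ⊓ centralizer (T : Set G) =
      MulAut.conj (h : G) • (Q.1.1 ⊓ centralizer (T : Set G))
    rw [smul_inf, conj_smul_centralizer_of_normalizer]

/-- A subgroup of `C_G(T)` equal to the `p`-core of its normalizer in `C_G(T)` contains
`O_p(C_G(T))`. -/
theorem opOf_centralizer_le_of_opOf_normalizer_le {P C : Subgroup G} (hP : IsPGroup p P)
    (hPC : P ≤ C) (hO : opOf p (normalizer (P : Set G) ⊓ C : Subgroup G) ≤ P) : opOf p C ≤ P := by
  by_contra hle
  have hPN : P ≤ normalizer (opOf p C : Set G) := hPC.trans (le_normalizer_opOf C)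
  have hR : IsPGroup p (P ⊔ opOf p C : Subgroup G) := hP.to_sup_of_normal_right' (isPGroup_opOf C) hPN
  -- Normalizers grow in `P O_p(C)`; modulo `P` the new element lies in `O_p(C) ∩ N(P)`, which is
  -- contained in `O_p(N_C(P)) ≤ P`.
  obtain ⟨r, hrR, hrN, hrP⟩ := hR.exists_mem_normalizer_of_lt
    (lt_of_le_of_ne le_sup_left fun h => hle (le_sup_right.trans h.ge))
  have hr : r ∈ (P : Set G) * (opOf p C : Set G) := by
    rw [← coe_mul_of_left_le_normalizer_right P _ hPN]
    exact hrR
  obtain ⟨a, ha, b, hb, rfl⟩ := hr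
  have hbN : b ∈ normalizer (P : Set G) := by
    simpa using mul_mem (inv_mem (le_normalizer ha)) hrN
  have hinf : opOf p C ⊓ (normalizer (P : Set G) ⊓ C) ≤ opOf p (normalizer (P : Set G) ⊓ C) :=
    le_opOf inf_le_right (isPGroup_opOf C).to_inf_left
      (le_normalizer_inf (inf_le_right.trans (le_normalizer_opOf C)) le_normalizer)
  exact hrP (mul_mem ha (hO (hinf ⟨hb, hbN, opOf_le C hb⟩)))

/-- If `P = T O_p(N_C(P))`, then `O_p(C) ≤ P`, so `P` is the full preimage of a `p`-subgroup of the
quotient; what has to be proved is that this subgroup is distinguished. -/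
theorem equivariantlyHomotopyEquivalent_distinguishedQuotient_left
    (hG : HasParabolicCharacteristic p G) (hT : IsNoncentralOfOrder p T)
    (hC : ¬ HasCharacteristic p (centralizer (T : Set G))) :
    EquivariantlyHomotopyEquivalent (normalizer (T : Set G))
      (OrderComplex (distinguishedBetween p T)) (OrderComplex (distinguishedQuotient p T)) := by
  have hTQ : ∀ Q : Subgroup (CentralizerQuotient p T), T ≤ quotientPreimage Q := fun Q =>
    hT.le_opOf_centralizer.trans (opOf_le_quotientPreimage Q)
  have hcM : ∀ P : Subgroup G, T ≤ P →
      centralizer (P : Set G) ≤ normalizer (P : Set G) ⊓ centralizer (T : Set G) := fun P hP =>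
    le_inf (centralizer_le_normalizer _) (centralizer_le hP)
  refine equivariantlyHomotopyEquivalent_of_lt_sup_opOf (p := p)
    (ρ := MulAut.conj.comp (normalizer (T : Set G)).subtype) (T := T)
    (C := centralizer (T : Set G)) hT.isPGroup hT.le_centralizer conj_smul_self_of_normalizer
    conj_smul_centralizer_of_normalizer (j := fun Q => Q.1.1)
    (fun _ _ => Iff.rfl) (fun _ _ => rfl)
    (i := fun Q => ⟨⟨quotientPreimage Q.1.1, Q.2, (hTQ _).trans le_normalizer⟩, hTQ _,
      quotientPreimage_le _⟩)
    (fun _ _ => quotientPreimage_le_iff)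
    (fun h Q => Subtype.ext (Subtype.ext (quotientPreimage_smul h Q.1.1)))
    (fun Q => Q.1.2.1.1.1) (fun Q => Q.2.2) (fun Q => Q.1.2.2) ?_ ?_ ?_
  · rintro ⟨⟨P, hP, hTN⟩, hTP, hPC⟩ hnot
    simp only
    have hPM : P ≤ normalizer (P : Set G) ⊓ centralizer (T : Set G) := le_inf le_normalizer hPC
    have hPO := le_opOf hPM hP.1.1 inf_le_left
    refine lt_of_le_of_ne (hPO.trans le_sup_right) fun h => hnot ?_
    have hOP := le_sup_right.trans h.ge
    obtain ⟨Q, hQ, rfl⟩ := exists_quotientPreimage_eq hP.1.1 hPC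
      (opOf_centralizer_le_of_opOf_normalizer_le hP.1.1 hPC hOP)
    have hM := hG.of_mem_distinguishedBrown hP hPM inf_le_left (hcM _ hTP)
    obtain ⟨S, hS⟩ := hQ.exists_le_sylow
    -- Applied to a whole Sylow subgroup `S` above `Q`, so that the image of `z`, once known to lie
    -- in `Q`, is `p`-central in the quotient and not merely central in `Q`.
    obtain ⟨z, hz, hzc, hzS, ho⟩ := exists_isPCentral_centralizing_preimage hG hT hC S.2
    have hzQ := centralizer_le (quotientPreimage_le_iff.2 hS) hzc
    have hzmem : (z : CentralizerQuotient p T) ∈ Q := coe_mem_quotientPreimage.1 <| hOP <|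
      hasCharacteristic_iff.1 hM z (hcM _ hTP hzQ) (centralizer_le hOP hzQ)
    exact ⟨⟨⟨Q, mem_distinguishedBrown_iff.2 ⟨hQ, z, hzmem, centralizer_le hS hzS,
      isPCentral_of_mem_sylow (hS hzmem) hzS ho⟩⟩, hP⟩, rfl⟩
  · intro P _ R hPR
    have hTR : T ≤ R.1.1 ⊓ (normalizer (P.1.1 : Set G) ⊓ centralizer (T : Set G)) :=
      le_inf R.2.1 (le_inf P.1.2.2 hT.le_centralizer)
    exact ⟨⟨⟨_, inf_mem_distinguishedBrown R.1.2.1 hPR.le (hcM _ P.2.1), hTR.trans le_normalizer⟩,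
      hTR, inf_le_right.trans inf_le_right⟩, rfl⟩
  · intro P _ D hD hDM hle
    have hTD : T ≤ D := le_sup_left.trans hle
    exact ⟨⟨⟨D, mem_distinguishedBrown_of_opOf_le hG P.1.2.1 (le_inf le_normalizer P.2.2)
      inf_le_left (hcM _ P.2.1) hD (le_sup_right.trans hle), hTD.trans le_normalizer⟩, hTD,
      hDM.trans inf_le_right⟩, rfl⟩

/-- Here the contraction takes place inside the quotient. If `Q = O_p(N(Q))`, characteristic `p` of
`N(Q)` puts into `Q` the image of a `p`-central element of `G` that centralizes the preimage, which
makes the preimage distinguished. -/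
theorem equivariantlyHomotopyEquivalent_distinguishedQuotient_right
    (hG : HasParabolicCharacteristic p G) (hT : IsNoncentralOfOrder p T)
    (hC : ¬ HasCharacteristic p (centralizer (T : Set G)))
    (hCbar : HasParabolicCharacteristic p (CentralizerQuotient p T)) :
    EquivariantlyHomotopyEquivalent (normalizer (T : Set G))
      (OrderComplex (distinguishedBrown p (CentralizerQuotient p T)))
      (OrderComplex (distinguishedQuotient p T)) := by
  refine equivariantlyHomotopyEquivalent_of_lt_sup_opOf (p := p)
    (ρ := conjCentralizerQuotient p T) (T := ⊥) (C := ⊤)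
    IsPGroup.of_bot bot_le (fun h => ?_) (fun h => ?_) (j := Subtype.val)
    (fun _ _ => Iff.rfl) (fun _ _ => rfl) (i := Subtype.val) (fun _ _ => Iff.rfl)
    (fun _ _ => rfl) (fun Q => Q.2.1.1) (fun _ => le_top) (fun _ => bot_le) ?_ ?_ ?_
  · exact Subgroup.map_bot _
  · exact eq_top_iff.2 fun x _ => mem_pointwise_smul_iff_inv_smul_mem.2 trivial
  · intro Q hnot
    rw [bot_sup_eq]
    have hQO := le_opOf (le_inf le_normalizer le_top) Q.2.1.1
      (inf_le_left (b := (⊤ : Subgroup (CentralizerQuotient p T))))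
    refine lt_of_le_of_ne hQO fun h => hnot ⟨⟨Q, ?_⟩, rfl⟩
    have hcM := le_inf (centralizer_le_normalizer
      (Q.1 : Set (CentralizerQuotient p T))) le_top
    have hM := hCbar.of_mem_distinguishedBrown Q.2 (le_inf le_normalizer le_top) inf_le_left hcM
    obtain ⟨z, hz, hzc, hzQ, -⟩ := exists_isPCentral_centralizing_preimage hG hT hC Q.2.1.1
    have hzmem : (z : CentralizerQuotient p T) ∈ Q.1 := h.ge <|
      hasCharacteristic_iff.1 hM z (hcM hzQ) (centralizer_le h.ge hzQ)
    exact mem_distinguishedBrown_iff.2 ⟨isPGroup_quotientPreimage Q.2.1.1, z,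
      coe_mem_quotientPreimage.2 hzmem, hzc, hz⟩
  · intro Q _ R hQR
    exact ⟨⟨_, inf_mem_distinguishedBrown R.2 hQR.le
      (le_inf (centralizer_le_normalizer _) le_top)⟩, rfl⟩
  · intro Q _ D hD _ hle
    exact ⟨⟨D, mem_distinguishedBrown_of_opOf_le hCbar Q.2 (le_inf le_normalizer le_top) inf_le_left
      (le_inf (centralizer_le_normalizer _) le_top) hD (le_sup_right.trans hle)⟩, rfl⟩

end FixedPoints

end

theorem theorem4p12 {G : Type*} [Group G] [Finite G] (p : ℕ) [Fact p.Prime]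
    (hG : HasParabolicCharacteristic p G)
    (T : Subgroup G) (hT : IsNoncentralOfOrder p T)
    (hC : ¬ HasCharacteristic p (centralizer (T : Set G)))
    (hCbar : HasParabolicCharacteristic p (CentralizerQuotient p T)) :
    EquivariantlyHomotopyEquivalent (normalizer (T : Set G))
      (OrderComplex (fixedCollection (distinguishedBrown p G) T))
      (OrderComplex (distinguishedBrown p (CentralizerQuotient p T))) :=
  (equivariantlyHomotopyEquivalent_distinguishedAbove hG hT).trans <|
    (equivariantlyHomotopyEquivalent_distinguishedBetween hT).trans <|
      (equivariantlyHomotopyEquivalent_distinguishedQuotient_left hG hT hC).trans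
        (equivariantlyHomotopyEquivalent_distinguishedQuotient_right hG hT hC hCbar).symm
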